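/- Throughout, $\ell^2=\ell^2(\{0,1,2,\dots\})$ is the complex Hilbert space with standard basis $e_0,e_1,\dots$; a Jacobi operator is a bounded operator $J$ on $\ell^2$ with real tridiagonal matrix $\langle e_k,Je_k\rangle=\alpha_k$, $\langle e_k,Je_{k+1}\rangle=\langle e_{k+1},Je_k\rangle=\beta_k>0$ and all other entries zero; $\Delta$ is the free Jacobi operator ($\alpha_k=0$, $\beta_k=\tfrac12$ for all $k$); $\sigma_p(J)$ is the set of eigenvalues of $J$. **Theorem.** Let $J=\Delta+F$ be a Toeplitz-plus-finite-rank Jacobi operator, i.e. $F$ has finite rank $r$, and let $r$ be known a priori. Then the point spectrum $\sigma_p(J)$ is computable with error control in the Hausdorff metric, in real-number arithmetic. That is, $\sigma_p(J)$ is always compact, and there are two programs, which use rational operations on real numbers and exact comparisons of real numbers, natural-number counters and indices, and no real constants other than natural numbers, such that: 1. for every such $J$ and every $n\in\mathbb N$, the first program, given $n$, $r$ and access to the individual entries $\alpha_k$ and $\beta_k$, halts after finitely many operations and outputs a finite set $\Gamma_n(J)\subset\mathbb R$, and $\Gamma_n(J)\to\sigma_p(J)$ in the Hausdorff metric as $n\to\infty$;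 2. for every real $\varepsilon>0$, the second program, given $\varepsilon$, halts after finitely many operations and outputs an $N(\varepsilon)\in\mathbb N$ such that $d_H(\Gamma_n(J),\sigma_p(J))<\varepsilon$ for all $n\ge N(\varepsilon)$ and all such $J$. Here $d_H(\emptyset,\emptyset)=0$ and $d_H(\emptyset,A)=\infty$ for $A\neq\emptyset$. -/

import Mathlib

open Filter Topology

/-! ### While programs over the real field

Machine model for real-number arithmetic: while programs with finitely many natural-number
registers and finitely many unbounded arrays of real numbers. One operation is a rational
operation on stored reals, an exact comparison of two reals, or an operation on natural numbers
(which serve as counters and array indices). The only real constants are natural numbers, so no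
information can be hidden in a constant of a program. -/

namespace RealRAM

/-- Memory: natural-number registers and arrays of reals. -/
@[ext] structure State where
  nat : ℕ → ℕ
  arr : ℕ → ℕ → ℝ

/-- Natural-number expressions. -/
inductive NExp where
  | lit (n : ℕ)
  | reg (i : ℕ)
  | add (e f : NExp)
  | sub (e f : NExp)
  | mul (e f : NExp)

/-- Value of a natural-number expression (subtraction is truncated). -/
def NExp.eval (s : State) : NExp → ℕ
  | lit n => n
  | reg i => s.nat i
  | add e f => e.eval s + f.eval s
  | sub e f => e.eval s - f.eval s
  | mul e f => e.eval s * f.eval s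

/-- Real expressions; `cell a e` is the entry of array `a` at the index `e`. -/
inductive RExp where
  | ofNat (e : NExp)
  | cell (a : ℕ) (e : NExp)
  | add (x y : RExp)
  | sub (x y : RExp)
  | mul (x y : RExp)
  | div (x y : RExp)

/-- Value of a real expression. A quotient by zero has the value zero; as zero can be tested for
exactly, this convention gives no additional power. -/
noncomputable def RExp.eval (s : State) : RExp → ℝ
  | ofNat e => (e.eval s : ℝ)
  | cell a e => s.arr a (e.eval s)
  | add x y => x.eval s + y.eval s
  | sub x y => x.eval s - y.eval s
  | mul x y => x.eval s * y.eval s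
  | div x y => x.eval s / y.eval s

/-- Tests: exact comparisons and Boolean combinations of them. -/
inductive BExp where
  | natLT (e f : NExp)
  | realLT (x y : RExp)
  | not (b : BExp)
  | and (b c : BExp)

/-- Truth of a test. -/
def BExp.Holds (s : State) : BExp → Prop
  | natLT e f => e.eval s < f.eval s
  | realLT x y => x.eval s < y.eval s
  | not b => ¬ b.Holds s
  | and b c => b.Holds s ∧ c.Holds s

/-- Programs. -/
inductive Prog where
  | skip
  | setNat (i : ℕ) (e : NExp)
  | setReal (a : ℕ) (e : NExp) (x : RExp)
  | seq (P Q : Prog)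
  | ite (b : BExp) (P Q : Prog)
  | while (b : BExp) (P : Prog)

/-- `Exec P s t`: the program `P`, started in the memory state `s`, halts after finitely many
operations, in the memory state `t`. -/
inductive Exec : Prog → State → State → Prop where
  | skip (s : State) : Exec .skip s s
  | setNat (i : ℕ) (e : NExp) (s : State) :
      Exec (.setNat i e) s ⟨Function.update s.nat i (e.eval s), s.arr⟩
  | setReal (a : ℕ) (e : NExp) (x : RExp) (s : State) :
      Exec (.setReal a e x) s
        ⟨s.nat, Function.update s.arr a (Function.update (s.arr a) (e.eval s) (x.eval s))⟩
  | seq {P Q : Prog} {s t u : State} : Exec P s t → Exec Q t u → Exec (.seq P Q) s u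
  | ite_true {b : BExp} {P Q : Prog} {s t : State} :
      b.Holds s → Exec P s t → Exec (.ite b P Q) s t
  | ite_false {b : BExp} {P Q : Prog} {s t : State} :
      ¬ b.Holds s → Exec Q s t → Exec (.ite b P Q) s t
  | while_true {b : BExp} {P : Prog} {s t u : State} :
      b.Holds s → Exec P s t → Exec (.while b P) t u → Exec (.while b P) s u
  | while_false {b : BExp} {P : Prog} {s : State} :
      ¬ b.Holds s → Exec (.while b P) s s

/-- Programs are deterministic. -/
theorem Exec.unique {P : Prog} {s t u : State} (h : Exec P s t) (h' : Exec P s u) : t = u := by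
  induction h generalizing u with
  | skip s => cases h'; rfl
  | setNat i e s => cases h'; rfl
  | setReal a e x s => cases h'; rfl
  | seq _ _ ih₁ ih₂ =>
    cases h' with
    | seq k₁ k₂ => cases ih₁ k₁; exact ih₂ k₂
  | ite_true hb _ ih =>
    cases h' with
    | ite_true _ k => exact ih k
    | ite_false nb _ => exact absurd hb nb
  | ite_false hb _ ih =>
    cases h' with
    | ite_true b' _ => exact absurd b' hb
    | ite_false _ k => exact ih k
  | while_true hb _ _ ih₁ ih₂ =>
    cases h' with
    | while_true _ k₁ k₂ => cases ih₁ k₁; exact ih₂ k₂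
    | while_false nb => exact absurd hb nb
  | while_false hb =>
    cases h' with
    | while_true b' _ _ => exact absurd b' hb
    | while_false _ => rfl

/-- The natural number that a state presents as output. -/
def State.outNat (s : State) : ℕ := s.nat 0

/-- The finite set of reals that a state presents as output: the first entries of array `0`, as
many as register `0` says. -/
noncomputable def State.outSet (s : State) : Finset ℝ := (Finset.range (s.nat 0)).image (s.arr 0)

/-- The memory state that presents a real number `x` as input. -/
def ofReal (x : ℝ) : State where
  nat := fun _ => 0
  arr := fun a j => if a = 0 ∧ j = 0 then x else 0

/-- Let every instance `p` of a problem be given to the machine, together with a natural number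
`n`, as the memory state `load p n`, and let `Γ p` be the set to be computed. The problem is
*computable with error control* in the Hausdorff metric on compact subsets of the plane if

* every `Γ p` is compact;
* there are finite sets `approx p n`, computed by one program from `p` and `n`, that converge to
  `Γ p` for each `p` (a single limit);
* a second program computes, from `ε > 0` alone, an index from which on the error of `approx p n`
  is guaranteed to be less than `ε`, for every instance `p`.

The extended Hausdorff distance is used: the distance of the empty set to itself is `0`, to any
other set it is `∞`. -/
def ComputableWithErrorControl {ι : Type*} (load : ι → ℕ → State) (Γ : ι → Set ℂ) : Prop :=
  (∀ p, IsCompact (Γ p)) ∧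
  ∃ (approx : ι → ℕ → Finset ℝ) (index : ℝ → ℕ),
    (∃ P : Prog, ∀ p n, ∃ t, Exec P (load p n) t ∧ t.outSet = approx p n) ∧
    (∀ p, Tendsto (fun n => Metric.hausdorffEDist (Complex.ofReal '' (approx p n)) (Γ p))
      atTop (𝓝 0)) ∧
    (∃ Q : Prog, ∀ ε : ℝ, 0 < ε → ∃ t, Exec Q (ofReal ε) t ∧ t.outNat = index ε) ∧
    (∀ ε : ℝ, 0 < ε → ∀ p n, index ε ≤ n →
      Metric.hausdorffEDist (Complex.ofReal '' (approx p n)) (Γ p) < ENNReal.ofReal ε)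

end RealRAM

/-! ### Jacobi operators -/

namespace Jacobi

/-- The Hilbert space `ℓ²` of complex sequences indexed by `0, 1, 2, …`. -/
noncomputable abbrev L2 := lp (fun _ : ℕ => ℂ) 2

/-- The standard basis vector `e_j`. -/
noncomputable def e (j : ℕ) : L2 := lp.single 2 j (1 : ℂ)

/-- The tridiagonal matrix with diagonal `α` and off-diagonals `β`. -/
def tridiag (α β : ℕ → ℝ) (i j : ℕ) : ℝ :=
  if i = j then α i else if i = j + 1 then β j else if j = i + 1 then β i else 0

/-- `J` is the (bounded) Jacobi operator with diagonal entries `α k` and off-diagonal entries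
`β k > 0`. -/
structure IsJacobi (J : L2 →L[ℂ] L2) (α β : ℕ → ℝ) : Prop where
  pos : ∀ k, 0 < β k
  entry : ∀ i j, inner ℂ (e i) (J (e j)) = (tridiag α β i j : ℂ)

theorem orthonormal_e_succ : Orthonormal ℂ (fun k : ℕ => e (k + 1)) := by
  rw [orthonormal_iff_ite]
  intro i j
  simp only [e, lp.inner_single_left, lp.single_apply]
  by_cases h : i = j
  · simp [h]
  · simp [h]

/-- The right shift `e_k ↦ e_{k+1}`. -/
noncomputable def shift : L2 →L[ℂ] L2 :=
  (orthonormal_e_succ.orthogonalFamily.linearIsometry).toContinuousLinearMap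

/-- The free Jacobi operator `Δ`: half the sum of the right shift and its adjoint. -/
noncomputable def free : L2 →L[ℂ] L2 := (1 / 2 : ℂ) • (shift + ContinuousLinearMap.adjoint shift)

theorem shift_e (k : ℕ) : shift (e k) = e (k + 1) := by
  change orthonormal_e_succ.orthogonalFamily.linearIsometry (lp.single 2 k (1 : ℂ)) = _
  rw [OrthogonalFamily.linearIsometry_apply_single]
  simp

/-- The matrix of `Δ` has zero diagonal and off-diagonal entries `1/2`. -/
theorem isJacobi_free : IsJacobi free (fun _ => 0) (fun _ => 1 / 2) where
  pos _ := by norm_num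
  entry i j := by
    have key : ∀ a b : ℕ, inner ℂ (e a) (e b) = if a = b then (1 : ℂ) else 0 := by
      intro a b
      simp only [e, lp.inner_single_left, lp.single_apply]
      by_cases h : a = b
      · simp [h]
      · simp [h]
    simp only [free, smul_apply, add_apply,
      inner_smul_right, inner_add_right, ContinuousLinearMap.adjoint_inner_right, shift_e, key,
      tridiag]
    by_cases h1 : i = j
    · subst h1; simp
    · by_cases h2 : i = j + 1
      · subst h2; simp; omega
      · by_cases h3 : j = i + 1
        · subst h3; simp [show ¬ i = i + 1 + 1 by omega]
        · simp [h1, h2, h3, Ne.symm h3]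

/-- The point spectrum: the set of eigenvalues of an operator on `ℓ²`. -/
def pointSpectrum (J : L2 →L[ℂ] L2) : Set ℂ :=
  {z | Module.End.HasEigenvalue (J : L2 →ₗ[ℂ] L2) z}

/-- A Toeplitz-plus-finite-rank Jacobi operator `J = Δ + F`, with its coefficients and with the
rank of `F`. -/
structure ToeplitzPlusFiniteRank where
  α : ℕ → ℝ
  β : ℕ → ℝ
  F : L2 →L[ℂ] L2
  isJacobi : IsJacobi (free + F) α β
  r : ℕ
  rank_eq : LinearMap.rank (F : L2 →ₗ[ℂ] L2) = r

/-- What the machine is given: the entries `α k` and `β k` in the arrays `0` and `1`, the index `n`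
in register `0` and the rank of `F` in register `1`. A halting run inspects only finitely many of
the entries. -/
noncomputable def ToeplitzPlusFiniteRank.load (T : ToeplitzPlusFiniteRank) (n : ℕ) : RealRAM.State where
  nat := fun i => if i = 0 then n else if i = 1 then T.r else 0
  arr := fun a k => if a = 0 then T.α k else if a = 1 then T.β k else 0

end Jacobi

/-! The rank makes the problem finite. Reading the columns of the tridiagonal `F` and eliminating,
one knows the rank of the columns read so far. As soon as it equals `r`, these columns span the
range of `F`, so all later rows vanish and `J` is free beyond some index `m` (`tail`).

Beyond `m` an eigenvector solves the free recurrence. For a spectral parameter in `[0, 1)` a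
conserved positive definite form prevents decay. For a parameter `(w + 1/w)/2` with `w ≥ 1`, decay
forces the ratio `1/w`, and `w = 1` is excluded because the tail would be constant. Negative
eigenvalues are treated by conjugation with the signs `(-1)^k`, which turns `J` into minus the
operator with diagonal `-α`. Elimination of the free tail turns the condition at `m` into the
vanishing of a determinant of size `m + 1`, whose diagonal is `reduced` (`minor_reduced`,
`pointSpectrum_eq`).

This diagonal depends on `w` in a nonlinear way, but each entry increases strictly on `[1, ∞)`. So
Sturm's sign count of the leading minors never increases, and it drops between two points exactly if
there is a zero between them (`zeroCount_lt_iff`). At a rational `w` the count needs only rational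
operations and comparisons; the parameter `w` avoids square roots.

The program evaluates the count on the grid `1 + i/(n+1)` until it is zero, and records the
Joukowski image of the grid point at each drop. The Joukowski map is 1-Lipschitz on `[1, ∞)`, so the
error is at most `1/(n+1)`, uniformly in `J`; the index for `ε` therefore depends on `ε` only. -/

/-! ### Total correctness of programs -/

namespace RealRAM

/-- Weakest precondition: `P` halts when started in `s`, in a state that satisfies `R`. -/
def Wp (P : Prog) (R : State → Prop) (s : State) : Prop := ∃ t, Exec P s t ∧ R t

theorem Wp.mono {P : Prog} {R R' : State → Prop} {s : State} (h : Wp P R s)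
    (hR : ∀ t, R t → R' t) : Wp P R' s := by
  obtain ⟨t, ht, h⟩ := h
  exact ⟨t, ht, hR t h⟩

theorem wp_setNat {i : ℕ} {e : NExp} {R : State → Prop} {s : State} :
    Wp (.setNat i e) R s ↔ R ⟨Function.update s.nat i (e.eval s), s.arr⟩ :=
  ⟨fun ⟨_, h, hR⟩ => by cases h; exact hR, fun h => ⟨_, .setNat i e s, h⟩⟩

theorem wp_setReal {a : ℕ} {e : NExp} {x : RExp} {R : State → Prop} {s : State} :
    Wp (.setReal a e x) R s ↔ R ⟨s.nat, Function.update s.arr a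
      (Function.update (s.arr a) (e.eval s) (x.eval s))⟩ :=
  ⟨fun ⟨_, h, hR⟩ => by cases h; exact hR, fun h => ⟨_, .setReal a e x s, h⟩⟩

theorem wp_skip {R : State → Prop} {s : State} : Wp .skip R s ↔ R s :=
  ⟨fun ⟨_, h, hR⟩ => by cases h; exact hR, fun h => ⟨_, .skip s, h⟩⟩

theorem wp_seq {P Q : Prog} {R : State → Prop} {s : State} :
    Wp (.seq P Q) R s ↔ Wp P (Wp Q R) s := by
  constructor
  · rintro ⟨t, h, hR⟩
    cases h with
    | seq h₁ h₂ => exact ⟨_, h₁, _, h₂, hR⟩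
  · rintro ⟨t, h₁, u, h₂, hR⟩
    exact ⟨u, .seq h₁ h₂, hR⟩

theorem wp_ite {b : BExp} {P Q : Prog} {R : State → Prop} {s : State} :
    Wp (.ite b P Q) R s ↔ (b.Holds s → Wp P R s) ∧ (¬ b.Holds s → Wp Q R s) := by
  constructor
  · rintro ⟨t, h, hR⟩
    cases h with
    | ite_true hb h => exact ⟨fun _ => ⟨t, h, hR⟩, fun hn => absurd hb hn⟩
    | ite_false hb h => exact ⟨fun hn => absurd hn hb, fun _ => ⟨t, h, hR⟩⟩
  · rintro ⟨h₁, h₂⟩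
    by_cases hb : b.Holds s
    · obtain ⟨t, h, hR⟩ := h₁ hb
      exact ⟨t, .ite_true hb h, hR⟩
    · obtain ⟨t, h, hR⟩ := h₂ hb
      exact ⟨t, .ite_false hb h, hR⟩

/-- A loop that is left exactly after `K` rounds, with an invariant indexed by the round. -/
theorem wp_while {b : BExp} {P : Prog} (I : ℕ → State → Prop) (K : ℕ)
    (step : ∀ k < K, ∀ s, I k s → b.Holds s ∧ Wp P (I (k + 1)) s)
    (last : ∀ s, I K s → ¬ b.Holds s) {s : State} (h0 : I 0 s) :
    Wp (.while b P) (I K) s := by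
  have : ∀ d k, k + d = K → ∀ s, I k s → Wp (.while b P) (I K) s := by
    intro d
    induction d with
    | zero =>
      rintro k rfl s hs
      exact ⟨s, .while_false (last s hs), hs⟩
    | succ d ih =>
      intro k hk s hs
      obtain ⟨hb, t, ht, hI⟩ := step k (by omega) s hs
      obtain ⟨u, hu, hR⟩ := ih (k + 1) (by omega) t hI
      exact ⟨u, .while_true hb ht hu, hR⟩
  exact this K 0 (by omega) s h0

end RealRAM

/-! ### Sturm counts of symmetric tridiagonal matrices -/

namespace Sturm

/-- Leading principal minors of the tridiagonal matrix with diagonal `x` and off-diagonal `b`. -/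
def minor (x b : ℕ → ℝ) : ℕ → ℝ
  | 0 => 1
  | 1 => x 0
  | k + 2 => x (k + 1) * minor x b (k + 1) - b k ^ 2 * minor x b k

/-- Number of negative quotients of consecutive minors; a quotient by zero counts as negative. -/
noncomputable def count (x b : ℕ → ℝ) : ℕ → ℕ
  | 0 => 0
  | k + 1 => count x b k +
      if minor x b (k + 1) * minor x b k < 0 ∨ minor x b k = 0 then 1 else 0

/-- Since `b k ≠ 0`, two consecutive zeros would propagate down to the minor of index `0`, which is
`1`. -/
theorem minor_ne_zero {x b : ℕ → ℝ} (hb : ∀ k, 0 < b k) (k : ℕ) :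
    minor x b k = 0 → minor x b (k + 1) ≠ 0 := by
  induction k with
  | zero => simp [minor]
  | succ k ih =>
    intro h h'
    rw [minor, h] at h'
    have : minor x b k = 0 := by
      have := (hb k).ne'
      simpa [this] using h'
    exact ih this h

/-- The step of the comparison of two Sturm sequences: pairs (count, quotient) are compared
lexicographically, with a quotient by zero as least element. -/
theorem lex_step {c₁ c₂ : ℕ} {d₁ e₁ d₂ e₂ x₁ x₂ b : ℝ} (hb : 0 < b) (hx : x₁ < x₂)
    (h₁ : d₁ = 0 → e₁ ≠ 0) (h₂ : d₂ = 0 → e₂ ≠ 0)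
    (h : c₂ < c₁ ∨ c₁ = c₂ ∧ d₂ ≠ 0 ∧ (d₁ = 0 ∨ e₁ / d₁ < e₂ / d₂)) :
    (c₂ + if e₂ * d₂ < 0 ∨ d₂ = 0 then 1 else 0) < (c₁ + if e₁ * d₁ < 0 ∨ d₁ = 0 then 1 else 0) ∨
    (c₁ + if e₁ * d₁ < 0 ∨ d₁ = 0 then 1 else 0) = (c₂ + if e₂ * d₂ < 0 ∨ d₂ = 0 then 1 else 0) ∧
      e₂ ≠ 0 ∧ (e₁ = 0 ∨ (x₁ * e₁ - b ^ 2 * d₁) / e₁ < (x₂ * e₂ - b ^ 2 * d₂) / e₂) := by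
  -- With `q = e / d` the recurrence is `q ↦ x - b² / q`. It sends `-∞` and the negative half-line
  -- increasingly to `[x, ∞)`, raising the count by one, and `[0, ∞)` increasingly to `[-∞, x)`.
  -- With a larger count regarded as lower in the order, this is an increasing map of a lift of the
  -- projective line, and it also increases with `x`.
  have quot : ∀ x d e : ℝ, e ≠ 0 → (x * e - b ^ 2 * d) / e = x - b ^ 2 * (d / e) := by
    intro x d e he; field_simp
  have nonneg : ∀ d e : ℝ, ¬ (e * d < 0 ∨ d = 0) → d ≠ 0 ∧ 0 ≤ d / e ∧ 0 ≤ e / d := by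
    intro d e h
    push Not at h
    refine ⟨h.2, ?_, ?_⟩
    · rw [← mul_div_mul_right d e h.2]
      exact div_nonneg (mul_self_nonneg d) h.1
    · rw [← mul_div_mul_right e d h.2]
      exact div_nonneg h.1 (mul_self_nonneg d)
  have neg : ∀ d e : ℝ, (d = 0 → e ≠ 0) → (e * d < 0 ∨ d = 0) → e ≠ 0 ∧ d / e ≤ 0 ∧ e / d ≤ 0 := by
    rintro d e h0 (h | h)
    · have he : e ≠ 0 := by rintro rfl; simp at h
      have hd : d ≠ 0 := by rintro rfl; simp at h
      refine ⟨he, ?_, ?_⟩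
      · rw [← mul_div_mul_right d e hd]
        exact div_nonpos_of_nonneg_of_nonpos (mul_self_nonneg d) h.le
      · rw [← mul_div_mul_right e d hd]
        exact div_nonpos_of_nonpos_of_nonneg h.le (mul_self_nonneg d)
    · exact ⟨h0 h, by simp [h], by simp [h]⟩
  have hb2 : 0 < b ^ 2 := by positivity
  by_cases n₁ : e₁ * d₁ < 0 ∨ d₁ = 0 <;> by_cases n₂ : e₂ * d₂ < 0 ∨ d₂ = 0
  · simp only [n₁, n₂, if_true]
    rcases h with h | ⟨hc, hd₂, h⟩
    · left; omega
    · right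
      obtain ⟨a₁, a₂, a₃⟩ := neg _ _ h₁ n₁
      obtain ⟨b₁, b₂, b₃⟩ := neg _ _ h₂ n₂
      refine ⟨by omega, b₁, Or.inr ?_⟩
      rw [quot _ _ _ a₁, quot _ _ _ b₁]
      have : d₂ / e₂ ≤ d₁ / e₁ := by
        -- If `d₁ = 0`, the first quotient is `-∞`, and its inverse `d₁ / e₁` is correctly `0`.
        rcases h with h | h
        · simpa [h] using b₂
        · rw [← inv_div e₂ d₂, ← inv_div e₁ d₁]
          have : e₂ / d₂ < 0 := lt_of_le_of_ne b₃ (div_ne_zero b₁ hd₂)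
          exact (inv_le_inv_of_neg this (h.trans this)).2 h.le
      nlinarith
  · simp only [n₁, n₂, if_true, if_false]
    left
    rcases h with h | h <;> omega
  · simp only [n₁, n₂, if_true, if_false]
    rcases h with h | ⟨hc, hd₂, h⟩
    · rcases Nat.lt_or_ge (c₂ + 1) c₁ with h' | h'
      · left; omega
      · right
        obtain ⟨a₁, a₂, a₃⟩ := nonneg _ _ n₁
        obtain ⟨b₁, b₂, b₃⟩ := neg _ _ h₂ n₂
        refine ⟨by omega, b₁, ?_⟩
        by_cases he : e₁ = 0
        · exact Or.inl he
        right
        rw [quot _ _ _ he, quot _ _ _ b₁]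
        nlinarith
    · exfalso
      obtain ⟨a₁, a₂, a₃⟩ := nonneg _ _ n₁
      obtain ⟨b₁, b₂, b₃⟩ := neg _ _ h₂ n₂
      rcases h with h | h
      · exact a₁ h
      · linarith
  · simp only [n₁, n₂, if_false]
    rcases h with h | ⟨hc, hd₂, h⟩
    · left; omega
    · right
      obtain ⟨a₁, a₂, a₃⟩ := nonneg _ _ n₁
      obtain ⟨b₁, b₂, b₃⟩ := nonneg _ _ n₂
      replace h := h.resolve_left a₁
      have hlt : 0 < e₂ / d₂ := a₃.trans_lt h
      have he₂ : e₂ ≠ 0 := by rintro rfl; simp at hlt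
      refine ⟨by omega, he₂, ?_⟩
      by_cases he : e₁ = 0
      · exact Or.inl he
      right
      rw [quot _ _ _ he, quot _ _ _ he₂]
      have : d₂ / e₂ ≤ d₁ / e₁ := by
        rw [← inv_div e₂ d₂, ← inv_div e₁ d₁]
        exact inv_anti₀ (lt_of_le_of_ne a₃ (div_ne_zero he a₁).symm) h.le
      nlinarith

/-- The comparison is strict at every index. A zero of the second minor rules out the tie of the
counts, which is why `count_lt` gives a strict drop exactly at a zero. -/
theorem lex_lt {x₁ x₂ b : ℕ → ℝ} (hb : ∀ k, 0 < b k) (hx : ∀ k, x₁ k < x₂ k) (k : ℕ) :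
    count x₂ b k < count x₁ b k ∨ count x₁ b k = count x₂ b k ∧ minor x₂ b k ≠ 0 ∧
      (minor x₁ b k = 0 ∨ minor x₁ b (k + 1) / minor x₁ b k < minor x₂ b (k + 1) / minor x₂ b k) := by
  induction k with
  | zero => right; simp [count, minor, hx 0]
  | succ k ih =>
    exact lex_step (hb k) (hx (k + 1)) (minor_ne_zero hb k) (minor_ne_zero hb k) ih

theorem count_le {x₁ x₂ b : ℕ → ℝ} (hb : ∀ k, 0 < b k) (hx : ∀ k, x₁ k < x₂ k) (k : ℕ) :
    count x₂ b k ≤ count x₁ b k := by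
  rcases lex_lt hb hx k with h | h <;> omega

theorem count_lt {x₁ x₂ b : ℕ → ℝ} (hb : ∀ k, 0 < b k) (hx : ∀ k, x₁ k < x₂ k) {k : ℕ}
    (h0 : minor x₂ b (k + 1) = 0) : count x₂ b (k + 1) < count x₁ b (k + 1) := by
  rcases lex_lt hb hx (k + 1) with h | ⟨_, h, _⟩
  · exact h
  · exact absurd h0 h

/-- The count is locally constant where the last minor does not vanish. -/
theorem eventually_count_eq {x : ℝ → ℕ → ℝ} {b : ℕ → ℝ} (hb : ∀ k, 0 < b k) {S : Set ℝ}
    {w₀ : ℝ} (hm : ∀ k, ContinuousWithinAt (fun w => minor (x w) b k) S w₀) (k : ℕ) :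
    minor (x w₀) b k ≠ 0 → ∀ᶠ w in 𝓝[S] w₀, count (x w) b k = count (x w₀) b k := by
  have near : ∀ k, minor (x w₀) b k ≠ 0 →
      ∀ᶠ w in 𝓝[S] w₀, 0 < minor (x w) b k * minor (x w₀) b k := by
    intro k hk
    have : ContinuousWithinAt (fun w => minor (x w) b k * minor (x w₀) b k) S w₀ :=
      (hm k).mul continuousWithinAt_const
    exact this.eventually (lt_mem_nhds (mul_self_pos.2 hk))
  induction k using Nat.strong_induction_on with
  | _ k ih =>
    intro hk
    match k with
    | 0 => simp [count]
    | k + 1 =>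
      by_cases h : minor (x w₀) b k = 0
      -- An inner minor that vanishes at `w₀` has neighbours of opposite sign, there and nearby. The
      -- two quotients that involve it then contribute exactly one to the count, whatever its sign,
      -- so the induction jumps over it.
      · match k with
        | 0 => simp [minor] at h
        | k + 1 =>
          have hk' : minor (x w₀) b k ≠ 0 := fun h' => minor_ne_zero hb k h' h
          have hs : minor (x w₀) b (k + 2) = - (b k ^ 2 * minor (x w₀) b k) := by
            rw [minor, h]; ring
          have hb2 : 0 < b k ^ 2 := pow_pos (hb k) 2
          have claim : ∀ w, 0 < minor (x w) b (k + 2) * minor (x w₀) b (k + 2) →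
              0 < minor (x w) b k * minor (x w₀) b k →
              count (x w) b (k + 2) = count (x w) b k + 1 := by
            intro w h1 h2
            have h3 : minor (x w) b (k + 2) * minor (x w) b k < 0 := by
              rw [hs] at h1
              have h4 := mul_pos h1 h2
              have h5 : 0 < minor (x w₀) b k ^ 2 * b k ^ 2 := by positivity
              by_contra h6
              push Not at h6
              nlinarith [mul_nonneg h6 h5.le]
            rw [count, count]
            have h0 : minor (x w) b k ≠ 0 := by rintro h'; simp [h'] at h2
            rcases lt_trichotomy (minor (x w) b (k + 1) * minor (x w) b k) 0 with h6 | h6 | h6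
            · have h7 : ¬ (minor (x w) b (k + 1 + 1) * minor (x w) b (k + 1) < 0 ∨
                  minor (x w) b (k + 1) = 0) := by
                push Not
                constructor
                · by_contra h8
                  push Not at h8
                  have := mul_pos_of_neg_of_neg h6 h8
                  nlinarith [mul_nonneg (sq_nonneg (minor (x w) b (k + 1))) (neg_nonneg.2 h3.le)]
                · intro h8; simp [h8] at h6
              simp [h6, h7]
            · have : minor (x w) b (k + 1) = 0 := by simpa [h0] using h6
              simp [this, h0]
            · have h8 : minor (x w) b (k + 1 + 1) * minor (x w) b (k + 1) < 0 := by
                by_contra h8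
                push Not at h8
                have := mul_nonneg h6.le h8
                have h9 : 0 < minor (x w) b (k + 1) ^ 2 := by
                  have : minor (x w) b (k + 1) ≠ 0 := by intro h'; simp [h'] at h6
                  positivity
                nlinarith [mul_pos h9 (neg_pos.2 h3)]
              simp [h6.not_gt, h8, h0]
          filter_upwards [near _ hk, near _ hk', ih k (by omega) hk'] with w h1 h2 h3
          rw [claim w h1 h2, claim w₀ (mul_self_pos.2 hk) (mul_self_pos.2 hk'), h3]
      · filter_upwards [near _ hk, near _ h, ih k (by omega) h] with w h1 h2 h3
        have h0 : minor (x w) b k ≠ 0 := by rintro h'; simp [h'] at h2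
        have : (minor (x w) b (k + 1) * minor (x w) b k < 0 ↔
            minor (x w₀) b (k + 1) * minor (x w₀) b k < 0) := by
          have h4 := mul_pos h1 h2
          rw [mul_mul_mul_comm] at h4
          rcases pos_and_pos_or_neg_and_neg_of_mul_pos h4 with h5 | h5
          · simp [h5.1.not_gt, h5.2.not_gt]
          · simp [h5.1, h5.2]
        simp only [count, h3, this, h0, h]

theorem continuousOn_minor {x : ℝ → ℕ → ℝ} {b : ℕ → ℝ} {S : Set ℝ}
    (hx : ∀ k, ContinuousOn (fun w => x w k) S) (k : ℕ) :
    ContinuousOn (fun w => minor (x w) b k) S := by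
  induction k using Nat.strong_induction_on with
  | _ k ih =>
    match k with
    | 0 => simpa [minor] using continuousOn_const
    | 1 => simpa [minor] using hx 0
    | k + 2 =>
      simp only [minor]
      exact ((hx (k + 1)).mul (ih (k + 1) (by omega))).sub (continuousOn_const.mul (ih k (by omega)))

/-- Without a zero of the last minor in `(u, v]` the count does not drop from `u` to `v`. -/
theorem count_le_of_no_zero {x : ℝ → ℕ → ℝ} {b : ℕ → ℝ} (hb : ∀ k, 0 < b k) {u v : ℝ}
    (huv : u < v) (hx : ∀ k, ContinuousOn (fun w => x w k) (Set.Icc u v)) {k : ℕ}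
    (h0 : ∀ w ∈ Set.Ioc u v, minor (x w) b (k + 1) ≠ 0) :
    count (x u) b (k + 1) ≤ count (x v) b (k + 1) := by
  have hm := continuousOn_minor (b := b) hx
  have const : ∀ w ∈ Set.Ioc u v, count (x w) b (k + 1) = count (x v) b (k + 1) := by
    intro w hw
    have hc : ContinuousOn (fun w => count (x w) b (k + 1)) (Set.Ioc u v) := by
      intro w hw
      have := eventually_count_eq hb (S := Set.Ioc u v) (w₀ := w)
        (fun k => (hm k w ⟨hw.1.le, hw.2⟩).mono Set.Ioc_subset_Icc_self) (k + 1) (h0 w hw)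
      exact tendsto_nhds_of_eventually_eq this
    exact isPreconnected_Ioc.constant hc hw ⟨huv, le_rfl⟩
  have hu : u ∈ Set.Icc u v := ⟨le_rfl, huv.le⟩
  have hne : (𝓝[Set.Ioc u v] u).NeBot := by
    rw [nhdsWithin_Ioc_eq_nhdsGT huv]; infer_instance
  -- A zero at the left end is allowed. There the last quotient is zero and not counted, and the
  -- count one index lower is locally constant.
  by_cases hz : minor (x u) b (k + 1) = 0
  · have hk : minor (x u) b k ≠ 0 := fun h' => minor_ne_zero hb k h' hz
    have := eventually_count_eq hb (S := Set.Ioc u v) (w₀ := u)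
        (fun k => (hm k u hu).mono Set.Ioc_subset_Icc_self) k hk
    obtain ⟨w, hw, hw'⟩ := (this.and self_mem_nhdsWithin).exists
    rw [← const w hw', count, count, hw, hz]
    simp [hk]
  · have := eventually_count_eq hb (S := Set.Ioc u v) (w₀ := u)
        (fun k => (hm k u hu).mono Set.Ioc_subset_Icc_self) (k + 1) hz
    obtain ⟨w, hw, hw'⟩ := (this.and self_mem_nhdsWithin).exists
    rw [← const w hw', hw]

/-- A dominant diagonal makes the minors positive and nondecreasing. The monotonicity is part of the
induction because it bounds the subtracted term `b k ^ 2 * minor k`. -/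
theorem eventually_count_eq_zero {x : ℝ → ℕ → ℝ} {b : ℕ → ℝ}
    (hx : ∀ k, Tendsto (fun w => x w k) atTop atTop) (k : ℕ) :
    ∀ᶠ w in atTop, count (x w) b k = 0 ∧ 0 < minor (x w) b k ∧
      minor (x w) b k ≤ minor (x w) b (k + 1) := by
  induction k with
  | zero =>
    filter_upwards [(hx 0).eventually_ge_atTop 1] with w hw
    simpa [count, minor] using hw
  | succ k ih =>
    filter_upwards [ih, (hx (k + 1)).eventually_ge_atTop (1 + b k ^ 2)] with w ⟨h1, h2, h3⟩ h4
    refine ⟨?_, h2.trans_le h3, ?_⟩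
    · simp [count, h1, h2.ne', (mul_pos (h2.trans_le h3) h2).not_gt]
    · rw [minor]
      nlinarith [sq_nonneg (b k), mul_le_mul_of_nonneg_right h4 (h2.trans_le h3).le,
        mul_le_mul_of_nonneg_left h3 (sq_nonneg (b k))]

end Sturm

/-! ### Location of a finite rank perturbation -/

namespace Jacobi

theorem inner_e_left (k : ℕ) (x : L2) : inner ℂ (e k) x = x k := by
  simp [e, lp.inner_single_left]

theorem ToeplitzPlusFiniteRank.coe_F_e (T : ToeplitzPlusFiniteRank) (i k : ℕ) :
    T.F (e i) k = (tridiag T.α (fun j => T.β j - 1 / 2) k i : ℂ) := by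
  have h₁ := T.isJacobi.entry k i
  have h₂ := isJacobi_free.entry k i
  rw [add_apply, inner_add_right, h₂, inner_e_left] at h₁
  rw [eq_sub_of_add_eq' h₁]
  unfold tridiag
  split_ifs <;> push_cast <;> ring

theorem tridiag_comm (α β : ℕ → ℝ) (i j : ℕ) : tridiag α β i j = tridiag α β j i := by
  unfold tridiag
  split_ifs <;> first | omega | (subst_vars; rfl)

theorem tridiag_eq_zero {α β : ℕ → ℝ} {i j : ℕ} (h : i + 1 < j ∨ j + 1 < i) :
    tridiag α β i j = 0 := by
  unfold tridiag
  split_ifs <;> first | omega | rfl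

@[simp] theorem tridiag_self (α β : ℕ → ℝ) (i : ℕ) : tridiag α β i i = α i := by simp [tridiag]

@[simp] theorem tridiag_succ_left (α β : ℕ → ℝ) (i : ℕ) : tridiag α β (i + 1) i = β i := by
  simp [tridiag]

@[simp] theorem tridiag_succ_right (α β : ℕ → ℝ) (i : ℕ) : tridiag α β i (i + 1) = β i := by
  rw [tridiag, if_neg (by omega), if_neg (by omega), if_pos rfl]

/-- Elimination on the columns of the tridiagonal matrix with diagonal `α` and off-diagonal `b`:
the rank of the first `j` columns, and the two last entries of a vector orthogonal to them (the
first multiplied by an off-diagonal entry). -/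
noncomputable def elim (α b : ℕ → ℝ) : ℕ → ℕ × ℝ × ℝ
  | 0 => (0, 0, 1)
  | j + 1 =>
    if b j ≠ 0 then
      ((elim α b j).1 + 1, b j * (elim α b j).2.2,
        (0 - ((elim α b j).2.1 + α j * (elim α b j).2.2)) / b j)
    else
      ((elim α b j).1 + if (elim α b j).2.1 + α j * (elim α b j).2.2 ≠ 0 then 1 else 0, 0, 1)

/-- The vector of which `elim` keeps the last entries. -/
theorem exists_orthogonal (α b : ℕ → ℝ) (j : ℕ) :
    ((elim α b j).2.1 ≠ 0 ∨ (elim α b j).2.2 ≠ 0) ∧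
    ∃ y : ℕ → ℝ, (∀ k, j < k → y k = 0) ∧ y j = (elim α b j).2.2 ∧
      (∑ k ∈ Finset.range j, y k * tridiag α b j k = (elim α b j).2.1) ∧
      ∀ i < j, ∑ k ∈ Finset.range (j + 1), y k * tridiag α b i k = 0 := by
  induction j with
  | zero =>
    refine ⟨by simp [elim], fun k => if k = 0 then 1 else 0, ?_, by simp [elim], by simp [elim],
      by simp⟩
    intro k hk
    simp [hk.ne']
  | succ j ih =>
    obtain ⟨hne, y, hy0, hyj, hya, hy⟩ := ih
    -- If `b j = 0`, the columns read so far have no entry in row `j + 1`, so the unit vector there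
    -- is orthogonal to them.
    by_cases hb : b j = 0
    · refine ⟨by simp [elim, hb], fun k => if k = j + 1 then 1 else 0, ?_, by simp [elim, hb],
        ?_, ?_⟩
      · intro k hk; simp [hk.ne']
      · simp only [elim, hb]
        simp
      · intro i hi
        simp only [ite_mul, one_mul, zero_mul, Finset.sum_ite_eq']
        split_ifs
        · rcases Nat.lt_or_ge i j with h | h
          · exact tridiag_eq_zero (by omega)
          · obtain rfl : i = j := by omega
            simpa using hb
        · rfl
    · simp only [elim, ne_eq, hb, not_false_eq_true, if_true]
      set g := (elim α b j).2.1 + α j * (elim α b j).2.2 with hg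
      -- The old vector has product `g` with column `j`; the new last entry cancels it through `b
      -- j`.
      refine ⟨?_, fun k => if k = j + 1 then (0 - g) / b j else y k, ?_, by simp, ?_, ?_⟩
      · by_contra h
        push Not at h
        have h1 : (elim α b j).2.2 = 0 := by simpa [hb] using h.1
        have h2 : g = 0 := by simpa [hb] using h.2
        rw [h1, mul_zero, add_zero] at hg
        exact hne.elim (fun h => h (hg ▸ h2)) (fun h => h h1)
      · intro k hk
        simp [hk.ne', hy0 k (by omega)]
      · rw [Finset.sum_range_succ, Finset.sum_eq_zero]
        · simp [hyj, mul_comm]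
        · intro k hk
          rw [Finset.mem_range] at hk
          rw [tridiag_eq_zero (by omega), mul_zero]
      · intro i hi
        rw [Finset.sum_range_succ]
        have h1 : ∑ k ∈ Finset.range (j + 1), (if k = j + 1 then (0 - g) / b j else y k) *
            tridiag α b i k = ∑ k ∈ Finset.range (j + 1), y k * tridiag α b i k := by
          refine Finset.sum_congr rfl fun k hk => ?_
          rw [Finset.mem_range] at hk
          rw [if_neg (by omega)]
        rw [h1]
        rcases Nat.lt_or_ge i j with h | h
        · rw [hy i h, tridiag_eq_zero (by omega), mul_zero, add_zero]
        · obtain rfl : i = j := by omega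
          rw [Finset.sum_range_succ, hya, hyj]
          simp only [tridiag_self, if_true, tridiag_succ_right]
          rw [hg]
          field_simp
          ring

/-- The span of the first `j` columns. -/
noncomputable def ToeplitzPlusFiniteRank.columnSpan (T : ToeplitzPlusFiniteRank) (j : ℕ) :
    Submodule ℂ L2 :=
  Submodule.span ℂ ((fun i => T.F (e i)) '' Set.Iio j)

namespace ToeplitzPlusFiniteRank

variable (T : ToeplitzPlusFiniteRank)

theorem columnSpan_succ (j : ℕ) :
    T.columnSpan (j + 1) = T.columnSpan j ⊔ Submodule.span ℂ {T.F (e j)} := by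
  have : Set.Iio (j + 1) = insert j (Set.Iio j) := by ext i; simp
  rw [columnSpan, this, Set.image_insert_eq, Submodule.span_insert, sup_comm, columnSpan]

instance (j : ℕ) : FiniteDimensional ℂ (T.columnSpan j) :=
  FiniteDimensional.span_of_finite ℂ ((Set.finite_Iio j).image _)

theorem columnSpan_le_range (j : ℕ) : T.columnSpan j ≤ LinearMap.range (T.F : L2 →ₗ[ℂ] L2) := by
  rw [columnSpan, Submodule.span_le]
  rintro _ ⟨i, _, rfl⟩
  exact ⟨e i, rfl⟩

theorem columnSpan_le_ker {j : ℕ} (φ : L2 →ₗ[ℂ] ℂ) (h : ∀ i < j, φ (T.F (e i)) = 0) :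
    T.columnSpan j ≤ LinearMap.ker φ := by
  rw [columnSpan, Submodule.span_le]
  rintro _ ⟨i, hi, rfl⟩
  exact h i hi

/-- The perturbation's off-diagonal. -/
noncomputable def off (k : ℕ) : ℝ := T.β k - 1 / 2

theorem coe_F_e' (i k : ℕ) : T.F (e i) k = (tridiag T.α T.off k i : ℂ) := T.coe_F_e i k

/-- Two functionals kill the earlier columns: the coordinate `j + 1` and the product with the vector
of `exists_orthogonal`. If both kill column `j` too, symmetry of the matrix turns that vector into a
linear relation among the columns, in which column `j` has a nonzero coefficient. -/
theorem F_e_mem_columnSpan_iff (j : ℕ) : T.F (e j) ∈ T.columnSpan j ↔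
    T.off j = 0 ∧ (elim T.α T.off j).2.1 + T.α j * (elim T.α T.off j).2.2 = 0 := by
  obtain ⟨hne, y, hy0, hyj, hya, hy⟩ := exists_orthogonal T.α T.off j
  have hg : ∑ k ∈ Finset.range (j + 1), y k * tridiag T.α T.off j k =
      (elim T.α T.off j).2.1 + T.α j * (elim T.α T.off j).2.2 := by
    rw [Finset.sum_range_succ, hya, hyj, tridiag_self, mul_comm]
  constructor
  · intro h
    constructor
    · have h1 : T.columnSpan j ≤ LinearMap.ker
          (innerSL ℂ (e (j + 1)) : L2 →ₗ[ℂ] ℂ) := by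
        apply T.columnSpan_le_ker
        intro i hi
        simp only [ContinuousLinearMap.coe_coe, innerSL_apply_apply, inner_e_left, coe_F_e']
        rw [tridiag_eq_zero (by omega)]; simp
      have := h1 h
      simpa [inner_e_left, coe_F_e'] using this
    · have key : ∀ i, inner ℂ (∑ k ∈ Finset.range (j + 1), (y k : ℂ) • e k) (T.F (e i)) =
          ((∑ k ∈ Finset.range (j + 1), y k * tridiag T.α T.off i k : ℝ) : ℂ) := by
        intro i
        rw [sum_inner, Complex.ofReal_sum]
        refine Finset.sum_congr rfl fun k _ => ?_
        rw [inner_smul_left, inner_e_left, coe_F_e', tridiag_comm]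
        simp
      have h1 : T.columnSpan j ≤ LinearMap.ker
          (innerSL ℂ (∑ k ∈ Finset.range (j + 1), (y k : ℂ) • e k) : L2 →ₗ[ℂ] ℂ) := by
        apply T.columnSpan_le_ker
        intro i hi
        simp only [ContinuousLinearMap.coe_coe, innerSL_apply_apply]
        rw [key, hy i hi]; simp
      have := h1 h
      simp only [LinearMap.mem_ker, ContinuousLinearMap.coe_coe, innerSL_apply_apply] at this
      rw [key, hg] at this
      exact_mod_cast this
  · rintro ⟨hb, h0⟩
    -- If the last entry were zero, the vanishing product would make the other number kept by `elim`
    -- zero as well.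
    have hyj' : y j ≠ 0 := by
      rw [hyj]
      intro h
      rw [h, mul_zero, add_zero] at h0
      exact hne.elim (fun h => h h0) (fun h' => h' h)
    have hsum : ∑ k ∈ Finset.range (j + 1), (y k : ℂ) • T.F (e k) = 0 := by
      ext i
      rw [← inner_e_left, inner_sum]
      simp only [inner_smul_right, inner_e_left, coe_F_e']
      have : ∑ k ∈ Finset.range (j + 1), y k * tridiag T.α T.off i k = 0 := by
        rcases lt_trichotomy i j with h | rfl | h
        · exact hy i h
        · rw [hg, h0]
        · refine Finset.sum_eq_zero fun k hk => ?_
          rw [Finset.mem_range] at hk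
          by_cases hk' : k + 1 = i
          · obtain rfl : k = j := by omega
            subst hk'
            simp [hb]
          · rw [tridiag_eq_zero (by omega), mul_zero]
      have h' := congrArg (fun t : ℝ => (t : ℂ)) this
      push_cast at h'
      simpa using h'
    rw [Finset.sum_range_succ] at hsum
    have hc : (y j : ℂ) ≠ 0 := by exact_mod_cast hyj'
    have : T.F (e j) = -((y j : ℂ)⁻¹ • ∑ k ∈ Finset.range j, (y k : ℂ) • T.F (e k)) := by
      rw [← smul_neg, eq_inv_smul_iff₀ hc]
      exact eq_neg_of_add_eq_zero_right hsum
    rw [this]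
    refine neg_mem (Submodule.smul_mem _ _ (Submodule.sum_mem _ fun k hk => ?_))
    exact Submodule.smul_mem _ _ (Submodule.subset_span ⟨k, by simpa using hk, rfl⟩)

theorem finrank_columnSpan (j : ℕ) :
    Module.finrank ℂ (T.columnSpan j) = (elim T.α T.off j).1 := by
  induction j with
  | zero =>
    have : T.columnSpan 0 = ⊥ := by
      rw [columnSpan, Set.eq_empty_of_forall_notMem (s := Set.Iio 0) (by simp)]
      simp
    rw [this, finrank_bot]
    rfl
  | succ j ih =>
    by_cases h : T.F (e j) ∈ T.columnSpan j
    · have : T.columnSpan (j + 1) = T.columnSpan j := by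
        rw [columnSpan_succ, sup_eq_left, Submodule.span_singleton_le_iff_mem]
        exact h
      rw [this, ih]
      obtain ⟨h1, h2⟩ := (T.F_e_mem_columnSpan_iff j).1 h
      simp [elim, h1, h2]
    · have h1 : Module.finrank ℂ (T.columnSpan (j + 1)) = (elim T.α T.off j).1 + 1 := by
        have hd := Submodule.finrank_sup_add_finrank_inf_eq (T.columnSpan j)
          (Submodule.span ℂ {T.F (e j)})
        have h0 : T.F (e j) ≠ 0 := by rintro h'; exact h (h' ▸ zero_mem _)
        have hdis : T.columnSpan j ⊓ Submodule.span ℂ {T.F (e j)} = ⊥ := by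
          rw [← disjoint_iff]
          exact (Submodule.disjoint_span_singleton' h0).2 h
        rw [hdis, ← columnSpan_succ, finrank_bot, finrank_span_singleton h0, ih] at hd
        exact hd
      rw [h1]
      rw [F_e_mem_columnSpan_iff] at h
      by_cases hb : T.off j = 0
      · have : ¬ ((elim T.α T.off j).2.1 + T.α j * (elim T.α T.off j).2.2 = 0) := fun h' => h ⟨hb, h'⟩
        simp [elim, hb, this]
      · simp [elim, hb]

instance finiteDimensional_range :
    FiniteDimensional ℂ (LinearMap.range (T.F : L2 →ₗ[ℂ] L2)) := by
  have := T.rank_eq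
  rw [LinearMap.rank] at this
  exact Module.rank_lt_aleph0_iff.1 (this ▸ Cardinal.natCast_lt_aleph0)

theorem finrank_range : Module.finrank ℂ (LinearMap.range (T.F : L2 →ₗ[ℂ] L2)) = T.r := by
  have := T.rank_eq
  rw [LinearMap.rank] at this
  exact Module.finrank_eq_of_rank_eq this

theorem columnSpan_mono : Monotone T.columnSpan := by
  intro i j hij
  exact Submodule.span_mono (Set.image_mono (Set.Iio_subset_Iio hij))

theorem elim_le (j : ℕ) : (elim T.α T.off j).1 ≤ T.r := by
  rw [← finrank_columnSpan, ← finrank_range]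
  exact Submodule.finrank_mono (T.columnSpan_le_range j)

/-- This makes the search for the free tail terminate. Where the rank is maximal, all columns lie in
the span of those read; the span is finite-dimensional, hence closed, so by continuity it contains
the whole range. -/
theorem exists_elim_eq : ∃ j, (elim T.α T.off j).1 = T.r := by
  obtain ⟨j, hj⟩ : ∃ j, ∀ i, (elim T.α T.off i).1 ≤ (elim T.α T.off j).1 := by
    have hfin : (Set.range fun j => (elim T.α T.off j).1).Finite :=
      (Set.finite_Iic T.r).subset (by rintro _ ⟨j, rfl⟩; exact T.elim_le j)
    obtain ⟨_, ⟨⟨j, rfl⟩, hj⟩⟩ := hfin.exists_maximal ⟨_, 0, rfl⟩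
    refine ⟨j, fun i => ?_⟩
    rcases le_total ((elim T.α T.off i).1) ((elim T.α T.off j).1) with h | h
    · exact h
    · exact hj ⟨i, rfl⟩ h
  refine ⟨j, ?_⟩
  have hmem : ∀ i, T.F (e i) ∈ T.columnSpan j := by
    intro i
    have h1 : T.columnSpan j = T.columnSpan (max j (i + 1)) := by
      refine Submodule.eq_of_le_of_finrank_le (T.columnSpan_mono (le_max_left _ _)) ?_
      rw [finrank_columnSpan, finrank_columnSpan]
      exact hj _
    rw [h1]
    exact Submodule.subset_span ⟨i, by simp, rfl⟩
  suffices h : T.columnSpan j = LinearMap.range (T.F : L2 →ₗ[ℂ] L2) by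
    rw [← finrank_columnSpan, ← finrank_range, h]
  refine le_antisymm (T.columnSpan_le_range j) ?_
  rintro _ ⟨x, rfl⟩
  have hs := (lp.hasSum_single (p := 2) (by norm_num) x).mapL T.F
  refine (T.columnSpan j).closed_of_finiteDimensional.mem_of_tendsto hs ?_
  refine Eventually.of_forall fun s => Submodule.sum_mem _ fun i _ => ?_
  have : lp.single 2 i (x i) = (x i) • e i := by
    rw [e, ← lp.single_smul]; simp
  rw [this, map_smul]
  exact Submodule.smul_mem _ _ (hmem i)

/-- Once the columns read so far have full rank, the perturbation vanishes further on. -/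
theorem tail {j : ℕ} (h : (elim T.α T.off j).1 = T.r) :
    (∀ k, j < k → T.α k = 0) ∧ ∀ k, j ≤ k → T.β k = 1 / 2 := by
  have hr : T.columnSpan j = LinearMap.range (T.F : L2 →ₗ[ℂ] L2) := by
    refine Submodule.eq_of_le_of_finrank_le (T.columnSpan_le_range j) ?_
    rw [finrank_columnSpan, finrank_range, h]
  have key : ∀ i k, j < i → tridiag T.α T.off i k = 0 := by
    intro i k hi
    have h1 : T.columnSpan j ≤ LinearMap.ker (innerSL ℂ (e i) : L2 →ₗ[ℂ] ℂ) := by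
      apply T.columnSpan_le_ker
      intro l hl
      simp only [ContinuousLinearMap.coe_coe, innerSL_apply_apply, inner_e_left, coe_F_e']
      rw [tridiag_eq_zero (by omega)]; simp
    have h2 : T.F (e k) ∈ T.columnSpan j := hr ▸ ⟨e k, rfl⟩
    have := h1 h2
    simpa [inner_e_left, coe_F_e'] using this
  refine ⟨fun k hk => by simpa using key k k hk, fun k hk => ?_⟩
  -- The entry lies in row `k + 1`, so `k = j` is covered, unlike on the diagonal.
  have : T.off k = 0 := by simpa using key (k + 1) k (by omega)
  exact sub_eq_zero.1 this

end ToeplitzPlusFiniteRank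

end Jacobi

/-! ### Eigenvalues as zeros of a minor -/

namespace Jacobi

theorem hasSum_apply {J : L2 →L[ℂ] L2} {α β : ℕ → ℝ} (hJ : IsJacobi J α β) (x : L2) (i : ℕ) :
    HasSum (fun k => x k * (tridiag α β i k : ℂ)) (J x i) := by
  have hs := (lp.hasSum_single (p := 2) (by norm_num) x).mapL ((innerSL ℂ (e i)).comp J)
  simp only [ContinuousLinearMap.comp_apply, innerSL_apply_apply, inner_e_left (k := i)] at hs
  refine hs.congr_fun ?_
  intro k
  have : lp.single 2 k (x k) = (x k) • e k := by
    rw [e, ← lp.single_smul]; simp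
  rw [this, map_smul, lp.coeFn_smul, Pi.smul_apply, ← inner_e_left i (J (e k)), hJ.entry,
    smul_eq_mul]

theorem apply_zero {J : L2 →L[ℂ] L2} {α β : ℕ → ℝ} (hJ : IsJacobi J α β) (x : L2) :
    J x 0 = α 0 * x 0 + β 0 * x 1 := by
  have h := hasSum_sum_of_ne_finset_zero (L := SummationFilter.unconditional ℕ) (s := Finset.range 2)
    (f := fun k => x k * (tridiag α β 0 k : ℂ)) (by
      intro k hk
      rw [Finset.mem_range] at hk
      rw [tridiag_eq_zero (by omega)]; simp)
  rw [(hasSum_apply hJ x 0).unique h, Finset.sum_range_succ, Finset.sum_range_one, tridiag_self,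
    tridiag_succ_right]
  ring

theorem apply_succ {J : L2 →L[ℂ] L2} {α β : ℕ → ℝ} (hJ : IsJacobi J α β) (x : L2) (i : ℕ) :
    J x (i + 1) = β i * x i + α (i + 1) * x (i + 1) + β (i + 1) * x (i + 2) := by
  have h := hasSum_sum_of_ne_finset_zero (L := SummationFilter.unconditional ℕ) (s := Finset.range (i + 3))
    (f := fun k => x k * (tridiag α β (i + 1) k : ℂ)) (by
      intro k hk
      rw [Finset.mem_range] at hk
      rw [tridiag_eq_zero (by omega)]; simp)
  rw [(hasSum_apply hJ x (i + 1)).unique h, Finset.sum_range_succ, Finset.sum_range_succ,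
    Finset.sum_range_succ, Finset.sum_eq_zero, tridiag_self, tridiag_succ_right,
    tridiag_succ_left]
  · ring
  · intro k hk
    rw [Finset.mem_range] at hk
    rw [tridiag_eq_zero (by omega)]; simp

theorem IsJacobi.isSelfAdjoint {J : L2 →L[ℂ] L2} {α β : ℕ → ℝ} (hJ : IsJacobi J α β) :
    IsSelfAdjoint J := by
  have hJ' : IsJacobi (ContinuousLinearMap.adjoint J) α β := by
    refine ⟨hJ.pos, fun i j => ?_⟩
    rw [ContinuousLinearMap.adjoint_inner_right, ← inner_conj_symm, hJ.entry, tridiag_comm]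
    simp
  rw [ContinuousLinearMap.isSelfAdjoint_iff']
  ext x i
  exact (hasSum_apply hJ' x i).unique (hasSum_apply hJ x i)

/-- The solution, with value `1` at `0`, of the three-term recurrence of the Jacobi matrix with
diagonal `α` and off-diagonal `β` at the spectral parameter `l`. -/
noncomputable def solution (α β : ℕ → ℝ) (l : ℝ) : ℕ → ℝ
  | 0 => 1
  | 1 => (l - α 0) / β 0
  | k + 2 => ((l - α (k + 1)) * solution α β l (k + 1) - β k * solution α β l k) / β (k + 1)

/-- Cleared of denominators, the recurrence of the solution is that of the leading minors of `l -
J`. -/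
theorem prod_mul_solution {α β : ℕ → ℝ} (hβ : ∀ k, 0 < β k) (l : ℝ) (k : ℕ) :
    (∏ i ∈ Finset.range k, β i) * solution α β l k = Sturm.minor (fun i => l - α i) β k := by
  induction k using Nat.strong_induction_on with
  | _ k ih =>
    match k with
    | 0 => simp [solution, Sturm.minor]
    | 1 =>
      have := (hβ 0).ne'
      simp only [solution, Sturm.minor, Finset.prod_range_one]
      field_simp
    | k + 2 =>
      have := (hβ (k + 1)).ne'
      rw [Sturm.minor, ← ih (k + 1) (by omega), ← ih k (by omega), solution,
        Finset.prod_range_succ, Finset.prod_range_succ]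
      field_simp

theorem solution_ne_zero {α β : ℕ → ℝ} (hβ : ∀ k, 0 < β k) {l : ℝ} {k : ℕ}
    (h : solution α β l k = 0) : solution α β l (k + 1) ≠ 0 := by
  intro h'
  refine Sturm.minor_ne_zero (x := fun i => l - α i) hβ k ?_ ?_
  · rw [← prod_mul_solution hβ, h, mul_zero]
  · rw [← prod_mul_solution hβ, h', mul_zero]

theorem minor_congr {x y b : ℕ → ℝ} {k : ℕ} (h : ∀ i < k, x i = y i) :
    Sturm.minor x b k = Sturm.minor y b k := by
  induction k using Nat.strong_induction_on with
  | _ k ih =>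
    match k with
    | 0 => rfl
    | 1 => simpa [Sturm.minor] using h 0
    | k + 2 =>
      rw [Sturm.minor, Sturm.minor, ih (k + 1) (by omega) fun i hi => h i (by omega),
        ih k (by omega) fun i hi => h i (by omega), h (k + 1) (by omega)]

/-- The Joukowski map. -/
noncomputable def joukowski (w : ℝ) : ℝ := (w + 1 / w) / 2

/-- Diagonal of the tridiagonal matrix obtained from `joukowski w - J` by eliminating the rows
beyond `m`, where `J` is free. -/
noncomputable def reduced (α : ℕ → ℝ) (m : ℕ) (w : ℝ) (k : ℕ) : ℝ :=
  (if k < m then joukowski w else w / 2) - α k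

/-- The free tail contributes the Schur complement `joukowski w - 1 / (2 * w) = w / 2` in the last
row. Up to a nonzero factor, the determinant is the defect of the decay condition `y (m + 1) = y m /
w`. -/
theorem minor_reduced {α β : ℕ → ℝ} (hβ : ∀ k, 0 < β k) {m : ℕ} (hm : β m = 1 / 2) (w : ℝ) :
    Sturm.minor (reduced α m w) β (m + 1) = (∏ i ∈ Finset.range m, β i) / 2 *
      (solution α β (joukowski w) (m + 1) - solution α β (joukowski w) m / w) := by
  have h1 := prod_mul_solution (α := α) hβ (joukowski w) (m + 1)
  have h2 := prod_mul_solution (α := α) hβ (joukowski w) m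
  have h3 : Sturm.minor (reduced α m w) β (m + 1) =
      Sturm.minor (fun i => joukowski w - α i) β (m + 1) -
        (joukowski w - w / 2) * Sturm.minor (fun i => joukowski w - α i) β m := by
    match m with
    | 0 => simp [Sturm.minor, reduced]
    | m + 1 =>
      rw [Sturm.minor, Sturm.minor, minor_congr (y := fun i => joukowski w - α i),
        minor_congr (k := m) (y := fun i => joukowski w - α i)]
      · simp [reduced]; ring
      · intro i hi; simp [reduced, show i < m + 1 by omega]
      · intro i hi; simp [reduced, show i < m + 1 by omega]
  rw [h3, ← h1, ← h2, Finset.prod_range_succ, hm, joukowski]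
  ring

theorem tendsto_coe_zero (x : L2) : Tendsto (fun k => ‖x k‖) atTop (𝓝 0) := by
  have h := (lp.memℓp x).summable (by norm_num)
  have h0 := h.tendsto_atTop_zero
  simp only [ENNReal.toReal_ofNat, Real.rpow_ofNat] at h0
  have := h0.sqrt
  simpa using this

/-- A decaying solution of an eventually free recurrence. -/
theorem exists_joukowski_of_tendsto {α β : ℕ → ℝ} (hβ : ∀ k, 0 < β k) {m : ℕ}
    (hα : ∀ k, m < k → α k = 0) (hβm : ∀ k, m ≤ k → β k = 1 / 2) {l : ℝ} (hl : 0 ≤ l)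
    (h : Tendsto (solution α β l) atTop (𝓝 0)) :
    ∃ w, 1 < w ∧ l = joukowski w ∧ Sturm.minor (reduced α m w) β (m + 1) = 0 := by
  set y := solution α β l with hy
  have hrec : ∀ i, y (m + i + 2) = 2 * l * y (m + i + 1) - y (m + i) := by
    intro i
    rw [hy, solution, hα _ (by omega), hβm _ (by omega), hβm _ (by omega)]
    ring
  have hne : ∀ {k}, y k = 0 → y (k + 1) ≠ 0 := fun h => solution_ne_zero hβ h
  have t : ∀ j, Tendsto (fun i => y (m + i + j)) atTop (𝓝 0) := fun j =>
    h.comp (tendsto_atTop_mono (fun i => show i ≤ m + i + j by omega) tendsto_id)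
  rcases lt_or_ge l 1 with h1 | h1
  · exfalso
    -- The free recurrence conserves this quadratic form, which is positive definite for `0 ≤ l <
    -- 1`. Decay would make two consecutive values zero.
    have hE : ∀ i, y (m + i + 1) ^ 2 - 2 * l * y (m + i) * y (m + i + 1) + y (m + i) ^ 2 =
        y (m + 1) ^ 2 - 2 * l * y m * y (m + 1) + y m ^ 2 := by
      intro i
      induction i with
      | zero => simp
      | succ i ih =>
        rw [← ih, show m + (i + 1) + 1 = m + i + 2 by ring, hrec,
          show m + (i + 1) = m + i + 1 by ring]
        ring
    have hlim : Tendsto (fun i => y (m + i + 1) ^ 2 - 2 * l * y (m + i) * y (m + i + 1)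
        + y (m + i) ^ 2) atTop (𝓝 (0 ^ 2 - 2 * l * 0 * 0 + 0 ^ 2)) :=
      (((t 1).pow 2).sub (((t 0).const_mul (2 * l)).mul (t 1))).add ((t 0).pow 2)
    simp only [hE] at hlim
    have h0 := tendsto_nhds_unique hlim tendsto_const_nhds
    have hym : y m = 0 := by
      have h2 : (1 - l ^ 2) * y m ^ 2 ≤ 0 := by nlinarith [sq_nonneg (y (m + 1) - l * y m)]
      have h3 : 0 < 1 - l ^ 2 := by nlinarith
      have : y m ^ 2 ≤ 0 := by
        by_contra h4
        push Not at h4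
        nlinarith [mul_pos h3 h4]
      exact pow_eq_zero_iff (two_ne_zero) |>.1 (le_antisymm this (sq_nonneg _))
    refine hne hym ?_
    rw [hym] at h0
    have : y (m + 1) ^ 2 = 0 := by linarith
    exact pow_eq_zero_iff (two_ne_zero) |>.1 this
  · set w := l + √(l ^ 2 - 1) with hw
    have hr : √(l ^ 2 - 1) ^ 2 = l ^ 2 - 1 := Real.sq_sqrt (by nlinarith)
    have hr0 := Real.sqrt_nonneg (l ^ 2 - 1)
    have hw1 : 1 ≤ w := by linarith
    have hw0 : w ≠ 0 := by linarith
    have hwl : w + 1 / w = 2 * l := by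
      field_simp
      rw [hw]; linear_combination hr
    have hlw : l = joukowski w := by rw [joukowski, hwl]; ring
    -- The component along the growing solution `w ^ i` must vanish, since it does not tend to zero.
    have hd : ∀ i, y (m + i + 1) - y (m + i) / w = w ^ i * (y (m + 1) - y m / w) := by
      intro i
      induction i with
      | zero => simp
      | succ i ih =>
        rw [pow_succ', mul_assoc, ← ih, show m + (i + 1) + 1 = m + i + 2 by ring, hrec,
          show m + (i + 1) = m + i + 1 by ring, ← hwl]
        field_simp
        ring
    have hd0 : y (m + 1) - y m / w = 0 := by
      have hlim : Tendsto (fun i => |y (m + i + 1) - y (m + i) / w|) atTop (𝓝 |0 - 0 / w|) :=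
        ((t 1).sub ((t 0).div_const w)).abs
      have hle : ∀ i, |y (m + 1) - y m / w| ≤ |y (m + i + 1) - y (m + i) / w| := by
        intro i
        rw [hd, abs_mul]
        refine le_mul_of_one_le_left (abs_nonneg _) ?_
        rw [abs_of_nonneg (by positivity)]
        exact one_le_pow₀ hw1
      have := ge_of_tendsto' hlim hle
      simpa using this
    refine ⟨w, lt_of_le_of_ne hw1 ?_, hlw, ?_⟩
    · intro h1w
      have hconst : ∀ i, y (m + i) = y m := by
        intro i
        induction i with
        | zero => rfl
        | succ i ih =>
          have := hd i
          rw [hd0, mul_zero, ← h1w, div_one, sub_eq_zero] at this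
          rw [← ih, ← this]; rfl
      have hym : y m = 0 := by
        have := t 0
        simp only [add_zero, hconst] at this
        exact tendsto_nhds_unique tendsto_const_nhds this
      exact hne hym (by rw [hconst 1, hym])
    · rw [minor_reduced hβ (hβm m le_rfl), ← hlw, ← hy, hd0, mul_zero]

/-- Eigenvalues are real by self-adjointness, and an eigenvector is fixed by its entry at `0`, so
decay of `solution` is necessary. Conversely, a zero of the minor makes the tail geometric with
ratio `1 / w < 1`, hence square summable. -/
theorem pointSpectrum_eq {J : L2 →L[ℂ] L2} {α β : ℕ → ℝ} (hJ : IsJacobi J α β) {m : ℕ}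
    (hα : ∀ k, m < k → α k = 0) (hβm : ∀ k, m ≤ k → β k = 1 / 2) :
    pointSpectrum J = {z | ∃ s : ℝ, (s = 1 ∨ s = -1) ∧ ∃ w, 1 < w ∧
      Sturm.minor (reduced (fun k => s * α k) m w) β (m + 1) = 0 ∧
      z = ((s * joukowski w : ℝ) : ℂ)} := by
  have hβ := hJ.pos
  ext z
  constructor
  · intro hz
    obtain ⟨x, hx⟩ := hz.exists_hasEigenvector
    have hreal := hJ.isSelfAdjoint.isSymmetric.conj_eigenvalue_eq_self hz
    obtain ⟨l, rfl⟩ : ∃ l : ℝ, z = l := ⟨z.re, (Complex.conj_eq_iff_re.1 hreal).symm⟩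
    obtain ⟨s, hs, l', hl', rfl⟩ : ∃ s : ℝ, (s = 1 ∨ s = -1) ∧ ∃ l', 0 ≤ l' ∧ l = s * l' := by
      rcases le_total 0 l with h | h
      · exact ⟨1, Or.inl rfl, l, h, by ring⟩
      · exact ⟨-1, Or.inr rfl, -l, by linarith, by ring⟩
    have hs2 : s * s = 1 := by rcases hs with rfl | rfl <;> norm_num
    refine ⟨s, hs, ?_⟩
    have hJx : J x = ((s * l' : ℝ) : ℂ) • x := hx.apply_eq_smul
    -- The factor `s ^ k` implements the sign conjugation that replaces `α` by `s * α` and the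
    -- eigenvalue by its absolute value.
    have hsol : ∀ k, x k = x 0 * ((s ^ k * solution (fun k => s * α k) β l' k : ℝ) : ℂ) := by
      intro k
      induction k using Nat.strong_induction_on with
      | _ k ih =>
        match k with
        | 0 => simp [solution]
        | 1 =>
          have h := congrArg (fun u : L2 => u 0) hJx
          simp only [apply_zero hJ, lp.coeFn_smul, Pi.smul_apply, smul_eq_mul] at h
          have hb : (β 0 : ℂ) ≠ 0 := by exact_mod_cast (hβ 0).ne'
          have hs2c : (s : ℂ) * s = 1 := by exact_mod_cast hs2
          simp only [solution]
          push_cast at h ⊢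
          field_simp
          linear_combination h + α 0 * x 0 * hs2c
        | k + 2 =>
          have h := congrArg (fun u : L2 => u (k + 1)) hJx
          simp only [apply_succ hJ, lp.coeFn_smul, Pi.smul_apply, smul_eq_mul] at h
          rw [ih k (by omega), ih (k + 1) (by omega)] at h
          have hb : (β (k + 1) : ℂ) ≠ 0 := by exact_mod_cast (hβ (k + 1)).ne'
          have hs2c : (s : ℂ) * s = 1 := by exact_mod_cast hs2
          simp only [solution]
          push_cast at h ⊢
          rw [← mul_right_inj' hb]
          field_simp
          generalize ((solution (fun k => s * α k) β l' k : ℝ) : ℂ) = u at *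
          generalize ((solution (fun k => s * α k) β l' (k + 1) : ℝ) : ℂ) = v at *
          rw [pow_succ] at h
          rw [pow_succ, pow_succ]
          linear_combination h + (α (k + 1) * x 0 * s ^ k * s * v * hs2c) + x 0 * s ^ k * β k * u * hs2c
    have hx0 : x 0 ≠ 0 := by
      intro h0
      refine hx.2 ?_
      ext k
      rw [hsol k, h0, zero_mul]; rfl
    have hlim : Tendsto (solution (fun k => s * α k) β l') atTop (𝓝 0) := by
      rw [tendsto_zero_iff_norm_tendsto_zero]
      have h1 := (tendsto_coe_zero x).div_const ‖x 0‖
      rw [zero_div] at h1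
      refine h1.congr fun k => ?_
      have hs1 : |s| = 1 := by rcases hs with rfl | rfl <;> simp
      rw [hsol k, norm_mul, Complex.norm_real, norm_mul, norm_pow, Real.norm_eq_abs s, hs1,
        one_pow, one_mul, mul_div_cancel_left₀ _ (norm_ne_zero_iff.2 hx0)]
    obtain ⟨w, hw, hl, hmin⟩ := exists_joukowski_of_tendsto (α := fun k => s * α k) hβ
      (fun k hk => by simp [hα k hk]) hβm hl' hlim
    exact ⟨w, hw, hmin, by rw [hl]⟩
  · rintro ⟨s, hs, w, hw, hmin, rfl⟩
    have hs2 : s * s = 1 := by rcases hs with rfl | rfl <;> norm_num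
    have hw0 : w ≠ 0 := by linarith
    set y := solution (fun k => s * α k) β (joukowski w) with hy
    rw [minor_reduced hβ (hβm m le_rfl), ← hy] at hmin
    have hB : (∏ i ∈ Finset.range m, β i) / 2 ≠ 0 := by
      have := Finset.prod_pos (s := Finset.range m) (fun i _ => hβ i)
      positivity
    have h0 : y (m + 1) = y m / w := sub_eq_zero.1 ((mul_eq_zero.1 hmin).resolve_left hB)
    have hgeom : ∀ i, y (m + i + 1) = y (m + i) / w := by
      intro i
      induction i with
      | zero => exact h0
      | succ i ih =>
        rw [← add_assoc, hy, solution, hα _ (by omega), hβm _ (by omega), hβm _ (by omega), ← hy,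
          ih, joukowski]
        field_simp
        ring
    have hpow : ∀ i, y (m + i) = y m * (1 / w) ^ i := by
      intro i
      induction i with
      | zero => simp
      | succ i ih => rw [← add_assoc, hgeom, ih, pow_succ]; field_simp
    have hs1 : |s| = 1 := by rcases hs with rfl | rfl <;> simp
    have hmem : Memℓp (fun k => ((s ^ k * y k : ℝ) : ℂ)) 2 := by
      refine memℓp_gen ?_
      simp only [ENNReal.toReal_ofNat, Real.rpow_ofNat, Complex.norm_real, norm_mul, norm_pow,
        Real.norm_eq_abs s, hs1, one_pow, one_mul]
      rw [← summable_nat_add_iff m]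
      have hg : Summable fun i : ℕ => (y m) ^ 2 * ((1 / w) ^ 2) ^ i := by
        refine (summable_geometric_of_lt_one (by positivity) ?_).mul_left _
        have : 1 / w < 1 := by rw [div_lt_one (by linarith)]; exact hw
        have : 0 < 1 / w := by positivity
        nlinarith
      refine hg.congr fun i => ?_
      rw [add_comm i m, hpow i, Real.norm_eq_abs, sq_abs]
      ring
    let x : L2 := ⟨fun k => ((s ^ k * y k : ℝ) : ℂ), hmem⟩
    have hxk : ∀ k, x k = ((s ^ k * y k : ℝ) : ℂ) := fun _ => rfl
    refine Module.End.hasEigenvalue_of_hasEigenvector (x := x) ⟨?_, ?_⟩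
    · rw [Module.End.mem_eigenspace_iff]
      change J x = _
      ext k
      rw [lp.coeFn_smul, Pi.smul_apply, smul_eq_mul]
      match k with
      | 0 =>
        rw [apply_zero hJ, hxk, hxk, hy]
        have := (hβ 0).ne'
        have h : α 0 * (s ^ 0 * solution (fun k => s * α k) β (joukowski w) 0) +
            β 0 * (s ^ 1 * solution (fun k => s * α k) β (joukowski w) 1) =
            s * joukowski w * (s ^ 0 * solution (fun k => s * α k) β (joukowski w) 0) := by
          simp only [solution]
          field_simp
          linear_combination (-α 0) * hs2
        have h' := congrArg Complex.ofReal h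
        rw [Complex.ofReal_add, Complex.ofReal_mul (α 0), Complex.ofReal_mul (β 0),
          Complex.ofReal_mul (s * joukowski w)] at h'
        exact h'
      | k + 1 =>
        rw [apply_succ hJ, hxk, hxk, hxk, hy]
        have := (hβ (k + 1)).ne'
        have h : β k * (s ^ k * solution (fun k => s * α k) β (joukowski w) k) +
            α (k + 1) * (s ^ (k + 1) * solution (fun k => s * α k) β (joukowski w) (k + 1)) +
            β (k + 1) * (s ^ (k + 2) * solution (fun k => s * α k) β (joukowski w) (k + 2)) =
            s * joukowski w *
              (s ^ (k + 1) * solution (fun k => s * α k) β (joukowski w) (k + 1)) := by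
          rw [solution.eq_3]
          generalize solution (fun k => s * α k) β (joukowski w) k = u at *
          generalize solution (fun k => s * α k) β (joukowski w) (k + 1) = v at *
          rw [pow_succ s (k + 1), pow_succ]
          field_simp
          linear_combination (- s ^ k * s * α (k + 1) * v - s ^ k * β k * u) * hs2
        have h' := congrArg Complex.ofReal h
        rw [Complex.ofReal_add, Complex.ofReal_add, Complex.ofReal_mul (α (k + 1)),
          Complex.ofReal_mul (β k), Complex.ofReal_mul (β (k + 1)),
          Complex.ofReal_mul (s * joukowski w)] at h'
        exact h'
    · intro h
      have := congrArg (fun u : L2 => u 0) h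
      simp [hxk, hy, solution] at this

end Jacobi

/-! ### Counting the zeros of the minor -/

namespace Jacobi

theorem joukowski_sub {u v : ℝ} (hu : u ≠ 0) (hv : v ≠ 0) :
    joukowski v - joukowski u = (v - u) * (1 - 1 / (u * v)) / 2 := by
  unfold joukowski
  field_simp
  ring

theorem joukowski_lt {u v : ℝ} (hu : 1 ≤ u) (huv : u < v) : joukowski u < joukowski v := by
  rw [← sub_pos, joukowski_sub (by linarith) (by linarith)]
  have : 1 / (u * v) < 1 := by
    rw [div_lt_one (by nlinarith)]; nlinarith
  have := mul_pos (sub_pos.2 huv) (sub_pos.2 this)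
  linarith

theorem abs_joukowski_sub_le {u v : ℝ} (hu : 1 ≤ u) (huv : u ≤ v) :
    |joukowski v - joukowski u| ≤ v - u := by
  rw [joukowski_sub (by linarith) (by linarith)]
  have h1 : 1 / (u * v) ≤ 1 := by
    rw [div_le_one (by nlinarith)]; nlinarith
  have h2 : 0 ≤ 1 / (u * v) := by
    have : 0 ≤ u * v := by nlinarith
    positivity
  rw [abs_of_nonneg (by have := mul_nonneg (sub_nonneg.2 huv) (sub_nonneg.2 h1); linarith)]
  nlinarith [mul_nonneg (sub_nonneg.2 huv) h2]

/-- This monotonicity is what makes Sturm counting applicable to a determinant that is not a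
characteristic polynomial in `w`. -/
theorem reduced_lt (α : ℕ → ℝ) (m : ℕ) {u v : ℝ} (hu : 1 ≤ u) (huv : u < v) (k : ℕ) :
    reduced α m u k < reduced α m v k := by
  have := joukowski_lt hu huv
  unfold reduced
  split_ifs <;> linarith

theorem continuousOn_reduced (α : ℕ → ℝ) (m k : ℕ) :
    ContinuousOn (fun w => reduced α m w k) (Set.Ici 1) := by
  have hj : ContinuousOn joukowski (Set.Ici 1) := by
    unfold joukowski
    refine (continuousOn_id.add (continuousOn_const.div continuousOn_id ?_)).div_const _
    intro x hx
    have : (1 : ℝ) ≤ x := hx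
    simp only [id]; linarith
  unfold reduced
  split_ifs
  · exact hj.sub continuousOn_const
  · exact (continuousOn_id.div_const _).sub continuousOn_const

theorem tendsto_reduced (α : ℕ → ℝ) (m k : ℕ) :
    Tendsto (fun w => reduced α m w k) atTop atTop := by
  have h2 : Tendsto (fun w : ℝ => w / 2) atTop atTop := tendsto_id.atTop_div_const (by norm_num)
  have hj : Tendsto joukowski atTop atTop := by
    refine tendsto_atTop_mono' _ ?_ h2
    filter_upwards [eventually_gt_atTop 0] with w hw
    have : 0 < 1 / w := by positivity
    unfold joukowski
    linarith
  unfold reduced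
  split_ifs
  · exact tendsto_atTop_add_const_right _ (-α k) hj
  · exact tendsto_atTop_add_const_right _ (-α k) h2

/-- The zeros in `(1, ∞)` of the last minor. -/
def zeros (α β : ℕ → ℝ) (m : ℕ) : Set ℝ :=
  {w | 1 < w ∧ Sturm.minor (reduced α m w) β (m + 1) = 0}

/-- The number of zeros in `(w, ∞)` of the last minor. -/
noncomputable def zeroCount (α β : ℕ → ℝ) (m : ℕ) (w : ℝ) : ℕ :=
  Sturm.count (reduced α m w) β (m + 1)

variable {α β : ℕ → ℝ} {m : ℕ}

/-- The interval is half-open because a vanishing last minor is not counted: a zero at `v` has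
already left the count at `v`. For `u = 1` this excludes a zero at the threshold, which is no
eigenvalue. -/
theorem zeroCount_lt_iff (hβ : ∀ k, 0 < β k) {u v : ℝ} (hu : 1 ≤ u) (huv : u < v) :
    zeroCount α β m v < zeroCount α β m u ↔ ∃ w ∈ zeros α β m, u < w ∧ w ≤ v := by
  constructor
  · intro h
    by_contra h0
    push Not at h0
    refine (Sturm.count_le_of_no_zero (x := reduced α m) hβ huv
      (fun k => (continuousOn_reduced α m k).mono fun w hw => hu.trans hw.1) ?_).not_gt h
    intro w hw hz
    exact (h0 w ⟨hu.trans_lt hw.1, hz⟩ hw.1).not_ge hw.2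
  · rintro ⟨w, ⟨hw, hz⟩, huw, hwv⟩
    refine lt_of_le_of_lt ?_ (Sturm.count_lt hβ (reduced_lt α m hu huw) hz)
    rcases hwv.eq_or_lt with rfl | h
    · exact le_rfl
    · exact Sturm.count_le hβ (reduced_lt α m hw.le h) (m + 1)

theorem exists_zeroCount_eq_zero (α β : ℕ → ℝ) (m : ℕ) :
    ∃ W, ∀ w, W ≤ w → zeroCount α β m w = 0 := by
  obtain ⟨W, hW⟩ := eventually_atTop.1
    (Sturm.eventually_count_eq_zero (b := β) (tendsto_reduced α m) (m + 1))
  exact ⟨W, fun w hw => (hW w hw).1⟩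

theorem le_of_zeroCount_eq_zero (hβ : ∀ k, 0 < β k) {u w : ℝ} (hu : 1 ≤ u)
    (h : zeroCount α β m u = 0) (hw : w ∈ zeros α β m) : w ≤ u := by
  by_contra! huw
  have := (zeroCount_lt_iff (α := α) (m := m) hβ hu huw).2 ⟨w, hw, huw, le_rfl⟩
  omega

/-- The count drops strictly from each zero to the next, so it is injective on the zeros, and its
values are natural numbers below the one at `1`. -/
theorem finite_zeros (hβ : ∀ k, 0 < β k) : (zeros α β m).Finite := by
  have hlt : ∀ u ∈ zeros α β m, ∀ v ∈ zeros α β m, u < v →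
      zeroCount α β m v < zeroCount α β m u := fun u hu v hv huv =>
    (zeroCount_lt_iff hβ hu.1.le huv).2 ⟨v, hv, huv, le_rfl⟩
  refine Set.Finite.of_finite_image (f := zeroCount α β m)
    ((Set.finite_Iio (zeroCount α β m 1)).subset ?_) ?_
  · rintro _ ⟨w, hw, rfl⟩
    exact (zeroCount_lt_iff hβ le_rfl hw.1).2 ⟨w, hw, hw.1, le_rfl⟩
  · intro u hu v hv huv
    rcases lt_trichotomy u v with h | h | h
    · exact absurd huv (hlt u hu v hv h).ne'
    · exact h
    · exact absurd huv (hlt v hv u hu h).ne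

end Jacobi

/-! ### The programs -/

namespace RealRAM

/-- Entry `0` of an array, used as a real variable. -/
def var (a : ℕ) : RExp := .cell a (.lit 0)

/-- Assignment to a real variable. -/
def assign (a : ℕ) (x : RExp) : Prog := .setReal a (.lit 0) x

/-- A numeral as a real expression. -/
def num (n : ℕ) : RExp := .ofNat (.lit n)

/-- Increment of a register. -/
def incr (i : ℕ) : Prog := .setNat i (.add (.reg i) (.lit 1))

/-- The expression `(w + 1 / w) / 2` in the variable `7`. -/
def joukowskiExp : RExp := .div (.add (var 7) (.div (num 1) (var 7))) (num 2)

/-- One step of the Sturm count: row register `5`, count register `6`, minors in `9` and `10`. -/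
def countStep : Prog :=
  .seq (.ite (.natLT (.reg 5) (.reg 3))
    (assign 11 (.sub joukowskiExp (.mul (var 6) (.cell 0 (.reg 5)))))
    (assign 11 (.sub (.div (var 7) (num 2)) (.mul (var 6) (.cell 0 (.reg 5)))))) <|
  .seq (assign 12 (.sub (.mul (var 11) (var 10)) (var 9))) <|
  .seq (.ite (.and (.not (.realLT (.mul (var 12) (var 10)) (num 0)))
      (.realLT (num 0) (.mul (var 10) (var 10)))) .skip (incr 6)) <|
  .seq (assign 9 (.mul (.mul (.cell 1 (.reg 5)) (.cell 1 (.reg 5))) (var 10))) <|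
  .seq (assign 10 (var 12)) (incr 5)

/-- Computes in register `6` the number of zeros beyond the real number in the variable `7`,
for the sign in the variable `6`. -/
def countProg : Prog :=
  .seq (.setNat 5 (.lit 0)) <| .seq (.setNat 6 (.lit 0)) <| .seq (assign 9 (num 0)) <|
  .seq (assign 10 (num 1)) <| .while (.natLT (.reg 5) (.add (.reg 3) (.lit 1))) countStep

/-- One step of the sweep: appends an approximate zero to array `8` if the count drops. -/
def sweepStep : Prog :=
  .seq (assign 7 (.add (var 7) (.div (num 1) (.add (.ofNat (.reg 0)) (num 1))))) <|
  .seq countProg <|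
  .seq (.ite (.natLT (.reg 6) (.reg 2))
    (.seq (.setReal 8 (.reg 4) (.mul (var 6) joukowskiExp)) (incr 4)) .skip) <|
  .setNat 2 (.reg 6)

/-- Appends to array `8` approximations of the eigenvalues of the sign in the variable `6`. -/
def sweep : Prog :=
  .seq (assign 7 (num 1)) <| .seq countProg <| .seq (.setNat 2 (.reg 6)) <|
  .while (.natLT (.lit 0) (.reg 2)) sweepStep

/-- One elimination step: rank register `2`, column register `3`. -/
def locateStep : Prog :=
  .seq (assign 11 (.sub (.cell 1 (.reg 3)) (.div (num 1) (num 2)))) <|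
  .seq (assign 12 (.add (var 9) (.mul (.cell 0 (.reg 3)) (var 10)))) <|
  .seq (.ite (.realLT (num 0) (.mul (var 11) (var 11)))
    (.seq (incr 2) <| .seq (assign 9 (.mul (var 11) (var 10)))
      (assign 10 (.div (.sub (num 0) (var 12)) (var 11))))
    (.seq (.ite (.realLT (num 0) (.mul (var 12) (var 12))) (incr 2) .skip) <|
      .seq (assign 9 (num 0)) (assign 10 (num 1)))) <|
  incr 3

/-- Reads columns until the perturbation has the rank in register `1`. -/
def locate : Prog := .seq (assign 10 (num 1)) (.while (.natLT (.reg 2) (.reg 1)) locateStep)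

/-- Copies the list in array `8` to the output. -/
def output : Prog :=
  .seq (.setNat 5 (.lit 0)) <|
  .seq (.while (.natLT (.reg 5) (.reg 4))
    (.seq (.setReal 0 (.reg 5) (.cell 8 (.reg 5))) (incr 5))) <|
  .setNat 0 (.reg 4)

/-- The program that approximates the point spectrum. -/
def spectrumProg : Prog :=
  .seq locate <| .seq (assign 6 (num 1)) <| .seq sweep <|
  .seq (assign 6 (.sub (num 0) (num 1))) <| .seq sweep output

/-- The program that computes an index from an error bound. -/
def indexProg : Prog :=
  .while (.not (.realLT (num 1) (.mul (var 0) (.add (.ofNat (.reg 0)) (num 1))))) (incr 0)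

/-! ### Correctness of the counting program -/

open Jacobi

/-- The correction term in the recurrence of the minors. -/
def carry (x b : ℕ → ℝ) : ℕ → ℝ
  | 0 => 0
  | k + 1 => b k ^ 2 * Sturm.minor x b k

theorem minor_succ (x b : ℕ → ℝ) (k : ℕ) :
    Sturm.minor x b (k + 1) = x k * Sturm.minor x b k - carry x b k := by
  cases k <;> simp [Sturm.minor, carry]

/-- The frame conditions hold because only registers `5` and `6` and arrays `9` to `12` are written;
the sweep keeps its data elsewhere. Variable `9` holds `carry`, whose initial value `0` lets the
first row be treated like the others. -/
theorem wp_countProg (s : State) {R : State → Prop}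
    (hR : ∀ t : State, (∀ i < 5, t.nat i = s.nat i) → (∀ a < 9, t.arr a = s.arr a) →
      t.nat 6 = zeroCount (fun k => s.arr 6 0 * s.arr 0 k) (s.arr 1) (s.nat 3) (s.arr 7 0) →
      R t) :
    Wp countProg R s := by
  set x := reduced (fun k => s.arr 6 0 * s.arr 0 k) (s.nat 3) (s.arr 7 0) with hx
  set b := s.arr 1 with hb
  simp only [countProg, wp_seq, wp_setNat, assign, wp_setReal]
  refine (wp_while (fun k t => (∀ i < 5, t.nat i = s.nat i) ∧ (∀ a < 9, t.arr a = s.arr a) ∧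
    t.nat 5 = k ∧ t.nat 6 = Sturm.count x b k ∧ t.arr 9 0 = carry x b k ∧
    t.arr 10 0 = Sturm.minor x b k) (s.nat 3 + 1) ?_ ?_ ?_).mono ?_
  · rintro k hk t ⟨hn, ha, h5, h6, h9, h10⟩
    have hn3 := hn 3 (by norm_num)
    have ha0 := ha 0 (by norm_num)
    have ha1 := ha 1 (by norm_num)
    have ha6 := ha 6 (by norm_num)
    have ha7 := ha 7 (by norm_num)
    refine ⟨by simp [BExp.Holds, NExp.eval, hn3, h5]; omega, ?_⟩
    -- The two branches of the row test differ only in the diagonal entry stored in variable `11`;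
    -- the rest of the round is verified once for both.
    have hX : ∀ X : ℝ, X = x k → Wp (.seq (assign 12 (.sub (.mul (var 11) (var 10)) (var 9))) <|
        .seq (.ite (.and (.not (.realLT (.mul (var 12) (var 10)) (num 0)))
          (.realLT (num 0) (.mul (var 10) (var 10)))) .skip (incr 6)) <|
        .seq (assign 9 (.mul (.mul (.cell 1 (.reg 5)) (.cell 1 (.reg 5))) (var 10))) <|
        .seq (assign 10 (var 12)) (incr 5)) (fun t => (∀ i < 5, t.nat i = s.nat i) ∧
        (∀ a < 9, t.arr a = s.arr a) ∧ t.nat 5 = k + 1 ∧ t.nat 6 = Sturm.count x b (k + 1) ∧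
        t.arr 9 0 = carry x b (k + 1) ∧ t.arr 10 0 = Sturm.minor x b (k + 1))
        ⟨t.nat, Function.update t.arr 11 (Function.update (t.arr 11) 0 X)⟩ := by
      rintro X rfl
      have hT := minor_succ x b k
      simp only [wp_seq, assign, wp_setReal, wp_ite, wp_skip, incr, wp_setNat, NExp.eval,
        RExp.eval, var, num, BExp.Holds]
      simp only [ne_eq, Nat.reduceEqDiff, not_false_eq_true,
        Function.update_of_ne, Function.update_self, h9, h10, h5, h6, ← hT, Nat.cast_zero,
        mul_self_pos, ha1, ← hb]
      have hcarry : b k * b k * Sturm.minor x b k = carry x b (k + 1) := by rw [carry]; ring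
      constructor
      · intro hc
        refine ⟨fun i hi => by rw [Function.update_of_ne (by omega), hn i hi], fun a h => by
          rw [Function.update_of_ne (by omega), Function.update_of_ne (by omega),
            Function.update_of_ne (by omega), Function.update_of_ne (by omega), ha a h],
          trivial, ?_, hcarry, trivial⟩
        rw [Sturm.count, if_neg (by tauto), add_zero]
      · intro hc
        refine ⟨fun i hi => by
          rw [Function.update_of_ne (by omega), Function.update_of_ne (by omega), hn i hi],
          fun a h => by
          rw [Function.update_of_ne (by omega), Function.update_of_ne (by omega),
            Function.update_of_ne (by omega), Function.update_of_ne (by omega), ha a h],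
          trivial, ?_, hcarry, trivial⟩
        rw [Sturm.count, if_pos (by tauto)]
    rw [countStep, wp_seq, wp_ite]
    simp only [assign, wp_setReal, BExp.Holds, NExp.eval, h5, hn3]
    constructor
    · intro h
      refine hX _ ?_
      simp [RExp.eval, NExp.eval, var, num, joukowskiExp, hx, reduced, h, h5, ha0, ha6, ha7,
        joukowski]
    · intro h
      refine hX _ ?_
      simp [RExp.eval, NExp.eval, var, num, hx, reduced, h, h5, ha0, ha6, ha7]
  · rintro t ⟨hn, -, h5, -⟩
    simp [BExp.Holds, NExp.eval, hn 3, h5]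
  · refine ⟨fun i hi => ?_, fun a h => ?_, ?_, ?_, ?_, ?_⟩
    · simp only
      rw [Function.update_of_ne (by omega), Function.update_of_ne (by omega)]
    · simp only
      rw [Function.update_of_ne (by omega), Function.update_of_ne (by omega)]
    · simp [NExp.eval]
    · simp [NExp.eval, Sturm.count]
    · simp [NExp.eval, RExp.eval, num, carry]
    · simp [NExp.eval, RExp.eval, num, Sturm.minor]
  · rintro t ⟨hn, ha, -, h6, -⟩
    exact hR t hn ha h6

end RealRAM

/-! ### Correctness of the sweep, the location, the output and the index -/

namespace RealRAM

open Jacobi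

/-- From the state `s` to the state `t` the list in array `8` has been extended by points
`h`-close to `A`, and it now comes `h`-close to every point of `B`. -/
structure Appended (s t : State) (h : ℝ) (A B : Set ℝ) : Prop where
  nat0 : t.nat 0 = s.nat 0
  nat3 : t.nat 3 = s.nat 3
  arr : ∀ a < 7, t.arr a = s.arr a
  le : s.nat 4 ≤ t.nat 4
  keep : ∀ j < s.nat 4, t.arr 8 j = s.arr 8 j
  near : ∀ j < t.nat 4, s.nat 4 ≤ j → ∃ z ∈ A, |t.arr 8 j - z| ≤ h
  cover : ∀ z ∈ B, ∃ j < t.nat 4, |t.arr 8 j - z| ≤ h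

/-- A drop means a zero in the last grid cell, and the right end of the cell is then close to every
zero in it. One point per cell suffices, even if the count drops by more than one, since only sets
are compared. -/
theorem wp_sweepStep {s t : State} {α β : ℕ → ℝ} {σ u : ℝ} {m n : ℕ} (hβ : ∀ k, 0 < β k)
    (hσ : |σ| = 1) (h3 : s.nat 3 = m) (h1 : s.arr 1 = β) (h6 : s.arr 6 0 = σ)
    (hα : (fun k => σ * s.arr 0 k) = α) (hn : s.nat 0 = n) (hu : 1 ≤ u)
    (ht : Appended s t (1 / (n + 1)) ((σ * joukowski ·) '' zeros α β m)
      ((σ * joukowski ·) '' (zeros α β m ∩ Set.Iic u)))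
    (h7 : t.arr 7 0 = u) (h2 : t.nat 2 = zeroCount α β m u) :
    Wp sweepStep (fun t' => Appended s t' (1 / (n + 1)) ((σ * joukowski ·) '' zeros α β m)
      ((σ * joukowski ·) '' (zeros α β m ∩ Set.Iic (u + 1 / (n + 1)))) ∧
      t'.arr 7 0 = u + 1 / (n + 1) ∧ t'.nat 2 = zeroCount α β m (u + 1 / (n + 1))) t := by
  have hh : (0 : ℝ) < 1 / (n + 1) := by positivity
  set v := u + 1 / ((n : ℝ) + 1) with hv
  have huv : u < v := by linarith
  have close : ∀ w, u < w → w ≤ v →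
      |σ * joukowski v - σ * joukowski w| ≤ 1 / (n + 1) := by
    intro w h1 h2
    rw [← mul_sub, abs_mul, hσ, one_mul]
    exact (abs_joukowski_sub_le (by linarith) h2).trans (by linarith)
  simp only [sweepStep, wp_seq, assign, wp_setReal]
  refine wp_countProg _ ?_
  intro r hrn hra hr6
  have e7 : (RExp.add (var 7) (.div (num 1) (.add (.ofNat (.reg 0)) (num 1)))).eval t = v := by
    simp [RExp.eval, NExp.eval, var, num, h7, ht.nat0, hn, hv]
  rw [e7] at hr6 hra
  have a6 := ht.arr 6 (by norm_num)
  have a0 := ht.arr 0 (by norm_num)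
  have a1 := ht.arr 1 (by norm_num)
  simp only [ne_eq, OfNat.zero_ne_ofNat, OfNat.one_ne_ofNat, Nat.reduceEqDiff, not_false_eq_true,
    Function.update_of_ne, Function.update_self, NExp.eval, a6, a0, a1, h6, h1, hα, ht.nat3,
    h3] at hr6
  have n0 : r.nat 0 = s.nat 0 := by rw [hrn 0 (by norm_num)]; exact ht.nat0
  have n2 : r.nat 2 = zeroCount α β m u := by rw [hrn 2 (by norm_num)]; exact h2
  have n3 : r.nat 3 = s.nat 3 := by rw [hrn 3 (by norm_num)]; exact ht.nat3
  have n4 : r.nat 4 = t.nat 4 := by rw [hrn 4 (by norm_num)]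
  have r7 : r.arr 7 0 = v := by rw [hra 7 (by norm_num)]; simp [NExp.eval]
  have r8 : r.arr 8 = t.arr 8 := by rw [hra 8 (by norm_num)]; simp
  have rarr : ∀ a < 7, r.arr a = s.arr a := by
    intro a ha
    rw [hra a (by omega)]
    simp only
    rw [Function.update_of_ne (by omega), ht.arr a ha]
  have r6 : r.arr 6 0 = σ := by rw [rarr 6 (by norm_num), h6]
  simp only [wp_ite, wp_seq, wp_setReal, incr, wp_setNat, wp_skip, BExp.Holds, NExp.eval, n2, hr6,
    n4]
  rw [zeroCount_lt_iff hβ hu huv]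
  constructor
  · rintro ⟨w, hw, huw, hwv⟩
    have e8 : (RExp.mul (var 6) joukowskiExp).eval r = σ * joukowski v := by
      simp [RExp.eval, NExp.eval, var, num, joukowskiExp, r7, r6, joukowski]
    rw [e8]
    refine ⟨⟨?_, ?_, ?_, ?_, ?_, ?_, ?_⟩, ?_, ?_⟩
    · simpa using n0
    · simpa using n3
    · intro a ha
      simp only
      rw [Function.update_of_ne (by omega), rarr a ha]
    · simpa using ht.le.trans (Nat.le_succ _)
    · intro j hj
      have := ht.le
      simp only [Function.update_self]
      rw [Function.update_of_ne (by omega), r8, ht.keep j hj]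
    · intro j hj hj'
      simp only [Function.update_self, ne_eq, Nat.reduceEqDiff, not_false_eq_true,
        Function.update_of_ne] at hj ⊢
      by_cases h : j = t.nat 4
      · rw [h, Function.update_self]
        exact ⟨_, ⟨w, hw, rfl⟩, close w huw hwv⟩
      · rw [Function.update_of_ne h, r8]
        exact ht.near j (by omega) hj'
    · rintro _ ⟨w', ⟨hw', hle⟩, rfl⟩
      simp only [Function.update_self, ne_eq, Nat.reduceEqDiff, not_false_eq_true,
        Function.update_of_ne]
      rcases le_or_gt w' u with h | h
      · obtain ⟨j, hj, hj'⟩ := ht.cover _ ⟨w', ⟨hw', h⟩, rfl⟩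
        refine ⟨j, by omega, ?_⟩
        rw [Function.update_of_ne (by omega), r8]
        exact hj'
      · refine ⟨t.nat 4, by omega, ?_⟩
        rw [Function.update_self]
        exact close w' h hle
    · simpa using r7
    · simpa using hr6
  · intro hno
    push Not at hno
    refine ⟨⟨?_, ?_, ?_, ?_, ?_, ?_, ?_⟩, ?_, ?_⟩
    · simpa using n0
    · simpa using n3
    · exact rarr
    · simpa [n4] using ht.le
    · intro j hj
      simp only [r8, ht.keep j hj]
    · intro j hj hj'
      simp only [ne_eq, Nat.reduceEqDiff, not_false_eq_true, Function.update_of_ne, n4] at hj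
      simp only [r8]
      exact ht.near j hj hj'
    · rintro _ ⟨w', ⟨hw', hle⟩, rfl⟩
      simp only [ne_eq, Nat.reduceEqDiff, not_false_eq_true, Function.update_of_ne, n4, r8]
      rcases le_or_gt w' u with h | h
      · exact ht.cover _ ⟨w', ⟨hw', h⟩, rfl⟩
      · exact absurd hle (not_le.2 (hno w' hw' h))
    · simpa using r7
    · simp

theorem wp_sweep {s : State} {α β : ℕ → ℝ} {σ : ℝ} {m n : ℕ} (hβ : ∀ k, 0 < β k)
    (hσ : |σ| = 1) (h3 : s.nat 3 = m) (h1 : s.arr 1 = β) (h6 : s.arr 6 0 = σ)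
    (hα : (fun k => σ * s.arr 0 k) = α) (hn : s.nat 0 = n) :
    Wp sweep (fun t => Appended s t (1 / (n + 1)) ((σ * joukowski ·) '' zeros α β m)
      ((σ * joukowski ·) '' zeros α β m)) s := by
  have hh : (0 : ℝ) < 1 / (n + 1) := by positivity
  -- Termination needs no computed bound on the zeros: the grid eventually passes them all, and a
  -- zero count certifies this.
  have hex : ∃ i : ℕ, zeroCount α β m (1 + i * (1 / (n + 1))) = 0 := by
    obtain ⟨W, hW⟩ := exists_zeroCount_eq_zero α β m
    obtain ⟨i, hi⟩ := exists_nat_ge (W / (1 / ((n : ℝ) + 1)))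
    refine ⟨i, hW _ ?_⟩
    rw [div_le_iff₀ hh] at hi
    linarith
  classical
  have grid : ∀ i : ℕ, 1 ≤ 1 + (i : ℝ) * (1 / (n + 1)) := fun i => by
    have : 0 ≤ (i : ℝ) * (1 / (n + 1)) := by positivity
    linarith
  simp only [sweep, wp_seq, assign, wp_setReal]
  refine wp_countProg _ ?_
  intro t htn hta ht6
  simp only [wp_seq, wp_setNat]
  have e1 : (num 1).eval s = 1 := by simp [num, RExp.eval, NExp.eval]
  rw [e1] at ht6 hta
  simp only [ne_eq, OfNat.zero_ne_ofNat, OfNat.one_ne_ofNat, Nat.reduceEqDiff, not_false_eq_true,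
    Function.update_of_ne, Function.update_self, NExp.eval, h6, h1, hα, h3] at ht6
  refine (wp_while (fun i t => Appended s t (1 / (n + 1)) ((σ * joukowski ·) '' zeros α β m)
      ((σ * joukowski ·) '' (zeros α β m ∩ Set.Iic (1 + i * (1 / (n + 1))))) ∧
      t.arr 7 0 = 1 + i * (1 / (n + 1)) ∧ t.nat 2 = zeroCount α β m (1 + i * (1 / (n + 1))))
      (Nat.find hex) ?_ ?_ ?_).mono ?_
  · rintro i hi t ⟨ht, h7, h2⟩
    refine ⟨?_, ?_⟩
    · have := Nat.find_min hex hi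
      simp only [BExp.Holds, NExp.eval, h2]
      omega
    · have := wp_sweepStep hβ hσ h3 h1 h6 hα hn (grid i) ht h7 h2
      have hstep : 1 + ((i + 1 : ℕ) : ℝ) * (1 / (n + 1)) = 1 + i * (1 / (n + 1)) + 1 / (n + 1) := by
        push_cast; ring
      rw [hstep]
      exact this
  · rintro t ⟨-, -, h2⟩
    rw [BExp.Holds, NExp.eval, NExp.eval, h2, Nat.find_spec hex]
    exact lt_irrefl 0
  · have n4 : t.nat 4 = s.nat 4 := htn 4 (by norm_num)
    have a8 : t.arr 8 = s.arr 8 := by rw [hta 8 (by norm_num)]; simp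
    refine ⟨⟨?_, ?_, ?_, ?_, ?_, ?_, ?_⟩, ?_, ?_⟩
    · simpa using htn 0 (by norm_num)
    · simpa using htn 3 (by norm_num)
    · intro a ha
      simp only
      rw [hta a (by omega)]
      simp only
      rw [Function.update_of_ne (by omega)]
    · simp [n4]
    · intro j _
      simp [a8]
    · intro j hj hj'
      simp [n4] at hj
      omega
    · rintro _ ⟨w, ⟨hw, hle⟩, rfl⟩
      simp only [Nat.cast_zero, zero_mul, add_zero, Set.mem_Iic] at hle
      exact absurd hw.1 (not_lt.2 hle)
    · simp only [hta 7 (by norm_num)]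
      simp [NExp.eval]
    · simp [NExp.eval, ht6]
  · rintro t ⟨ht, -, -⟩
    have hsub : zeros α β m ∩ Set.Iic (1 + (Nat.find hex : ℕ) * (1 / ((n : ℝ) + 1))) =
        zeros α β m := by
      refine Set.inter_eq_left.2 fun w hw => ?_
      exact le_of_zeroCount_eq_zero hβ (grid _) (Nat.find_spec hex) hw
    rwa [hsub] at ht

/-- The rank reached never exceeds `r`, so the loop stops at the first column index with full rank.
The start relies on unused memory being zero. -/
theorem wp_locate (T : ToeplitzPlusFiniteRank) (n : ℕ) :
    Wp locate (fun t => t.nat 0 = n ∧ t.nat 4 = 0 ∧ t.arr 0 = T.α ∧ t.arr 1 = T.β ∧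
      (elim T.α T.off (t.nat 3)).1 = T.r) (T.load n) := by
  classical
  have hex := T.exists_elim_eq
  simp only [locate, wp_seq, assign, wp_setReal]
  refine (wp_while (fun j t => t.nat 0 = n ∧ t.nat 1 = T.r ∧ t.nat 4 = 0 ∧ t.arr 0 = T.α ∧
    t.arr 1 = T.β ∧ t.nat 3 = j ∧ t.nat 2 = (elim T.α T.off j).1 ∧
    t.arr 9 0 = (elim T.α T.off j).2.1 ∧ t.arr 10 0 = (elim T.α T.off j).2.2)
    (Nat.find hex) ?_ ?_ ?_).mono ?_
  · rintro j hj t ⟨h0, h1, h4, a0, a1, h3, h2, a9, a10⟩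
    refine ⟨?_, ?_⟩
    · have := lt_of_le_of_ne (T.elim_le j) (Nat.find_min hex hj)
      simpa [BExp.Holds, NExp.eval, h2, h1] using this
    · have hoff : T.β j - 1 / 2 = T.off j := rfl
      simp only [locateStep, wp_seq, assign, wp_setReal, wp_ite, wp_skip, incr, wp_setNat,
        NExp.eval, RExp.eval, var, num, BExp.Holds]
      simp only [ne_eq, OfNat.zero_ne_ofNat, OfNat.one_ne_ofNat, Nat.reduceEqDiff, not_false_eq_true,
        Function.update_of_ne, Function.update_self, h0, h1, h2, h3, h4, a0, a1, a9, a10,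
        Nat.cast_zero, Nat.cast_one, Nat.cast_ofNat, mul_self_pos, hoff, true_and]
      refine ⟨fun hb => ?_, fun hb => ⟨fun hg => ?_, fun hg => ?_⟩⟩
      · simp [elim, hb]
      · rw [not_not] at hb
        simp [elim, hb, hg]
      · rw [not_not] at hb hg
        simp [elim, hb, hg]
  · rintro t ⟨-, h1, -, -, -, -, h2, -⟩
    simp [BExp.Holds, NExp.eval, h1, h2, Nat.find_spec hex]
  · simp [ToeplitzPlusFiniteRank.load, elim, num, RExp.eval, NExp.eval]
  · rintro t ⟨h0, h1, h4, a0, a1, h3, h2, -⟩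
    exact ⟨h0, h4, a0, a1, h3 ▸ Nat.find_spec hex⟩

theorem wp_output (s : State) :
    Wp output (fun t => t.outSet = (Finset.range (s.nat 4)).image (s.arr 8)) s := by
  simp only [output, wp_seq, wp_setNat]
  refine (wp_while (fun k t => t.nat 4 = s.nat 4 ∧ t.nat 5 = k ∧ t.arr 8 = s.arr 8 ∧
    ∀ j < k, t.arr 0 j = s.arr 8 j) (s.nat 4) ?_ ?_ ?_).mono ?_
  · rintro k hk t ⟨h4, h5, a8, h⟩
    refine ⟨by simpa [BExp.Holds, NExp.eval, h4, h5] using hk, ?_⟩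
    simp only [wp_seq, wp_setReal, incr, wp_setNat, NExp.eval, RExp.eval]
    refine ⟨by simpa using h4, by simp [h5], by simpa using a8, fun j hj => ?_⟩
    simp only [Function.update_self, h5]
    by_cases hjk : j = k
    · rw [hjk, Function.update_self, a8]
    · rw [Function.update_of_ne hjk, h j (by omega)]
  · rintro t ⟨h4, h5, -⟩
    simp [BExp.Holds, NExp.eval, h4, h5]
  · simp [NExp.eval]
  · rintro t ⟨h4, -, -, h⟩
    simp only [wp_setNat, State.outSet, Function.update_self, NExp.eval, h4]
    refine Finset.image_congr fun j hj => ?_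
    exact h j (by simpa using hj)

theorem wp_indexProg {ε : ℝ} (hε : 0 < ε) :
    Wp indexProg (fun t => 1 / ((t.outNat : ℝ) + 1) < ε) (ofReal ε) := by
  classical
  have hex : ∃ i : ℕ, 1 < ε * (i + 1) := by
    obtain ⟨i, hi⟩ := exists_nat_gt (1 / ε)
    refine ⟨i, ?_⟩
    rw [div_lt_iff₀ hε] at hi
    linarith
  refine (wp_while (fun k t => t.nat 0 = k ∧ t.arr 0 0 = ε) (Nat.find hex) ?_ ?_ ?_).mono ?_
  · rintro k hk t ⟨h0, a0⟩
    refine ⟨?_, ?_⟩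
    · have := Nat.find_min hex hk
      simpa [BExp.Holds, NExp.eval, RExp.eval, var, num, h0, a0] using this
    · simp [incr, wp_setNat, NExp.eval, h0, a0]
  · rintro t ⟨h0, a0⟩
    have := Nat.find_spec hex
    simpa [BExp.Holds, NExp.eval, RExp.eval, var, num, h0, a0] using this
  · simp [ofReal]
  · rintro t ⟨h0, -⟩
    have := Nat.find_spec hex
    rw [State.outNat, h0, div_lt_iff₀ (by positivity)]
    exact this

/-- The output of `spectrumProg` on the index `n` has error at most `1 / (n + 1)`. -/
theorem wp_spectrumProg (T : ToeplitzPlusFiniteRank) (n : ℕ) :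
    Wp spectrumProg (fun t => Metric.hausdorffEDist (Complex.ofReal '' (t.outSet : Set ℝ))
      (pointSpectrum (free + T.F)) ≤ ENNReal.ofReal (1 / (n + 1))) (T.load n) := by
  have hβ := T.isJacobi.pos
  simp only [spectrumProg, wp_seq]
  refine (wp_locate T n).mono ?_
  rintro s ⟨h0, h4, a0, a1, hr⟩
  obtain ⟨hα, hβm⟩ := T.tail hr
  simp only [wp_seq, assign, wp_setReal]
  refine Wp.mono (wp_sweep (σ := 1) (m := s.nat 3) (n := n) (α := fun k => 1 * T.α k) hβ (by simp) rfl
    (by simpa using a1) (by simp [NExp.eval, RExp.eval, num]) (by simp [a0]) h0) ?_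
  intro t ht
  have b0 : t.arr 0 = T.α := by rw [ht.arr 0 (by norm_num)]; simpa using a0
  have b1 : t.arr 1 = T.β := by rw [ht.arr 1 (by norm_num)]; simpa using a1
  simp only [wp_seq, wp_setReal]
  refine Wp.mono (wp_sweep (σ := -1) (m := s.nat 3) (n := n) (α := fun k => -1 * T.α k) hβ (by simp)
    ht.nat3 (by simpa using b1) (by simp [NExp.eval, RExp.eval, num]) (by simp [b0])
    (ht.nat0.trans h0)) ?_
  intro u hu
  refine (wp_output u).mono ?_
  intro v hv
  have k1 : ∀ j < t.nat 4, u.arr 8 j = t.arr 8 j := fun j hj => by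
    rw [hu.keep j hj]; simp
  have k2 : t.nat 4 ≤ u.nat 4 := hu.le
  have dist_eq : ∀ x y : ℝ, ∀ _ : |x - y| ≤ 1 / ((n : ℝ) + 1),
      edist (x : ℂ) (y : ℂ) ≤ ENNReal.ofReal (1 / (n + 1)) := by
    intro x y h
    rw [edist_dist, Complex.dist_eq, ← Complex.ofReal_sub, Complex.norm_real]
    exact ENNReal.ofReal_le_ofReal h
  rw [hv, pointSpectrum_eq T.isJacobi hα hβm]
  -- Empty sets need no separate case: each of the two conditions forces its source to be empty if
  -- its target is.
  refine Metric.hausdorffEDist_le_of_mem_edist ?_ ?_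
  · rintro _ ⟨x, hx, rfl⟩
    obtain ⟨j, hj, rfl⟩ := Finset.mem_image.1 (Finset.mem_coe.1 hx)
    rw [Finset.mem_range] at hj
    rcases Nat.lt_or_ge j (t.nat 4) with h | h
    · obtain ⟨z, ⟨w, hw, rfl⟩, hz⟩ := ht.near j h (by simp [h4])
      rw [k1 j h]
      exact ⟨_, ⟨1, Or.inl rfl, w, hw.1, hw.2, rfl⟩, dist_eq _ _ hz⟩
    · obtain ⟨z, ⟨w, hw, rfl⟩, hz⟩ := hu.near j hj h
      exact ⟨_, ⟨-1, Or.inr rfl, w, hw.1, hw.2, rfl⟩, dist_eq _ _ hz⟩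
  · rintro _ ⟨σ, hσ, w, hw, hmin, rfl⟩
    suffices h : ∃ j < u.nat 4, |u.arr 8 j - σ * joukowski w| ≤ 1 / ((n : ℝ) + 1) by
      obtain ⟨j, hj, h⟩ := h
      refine ⟨_, ⟨u.arr 8 j, ?_, rfl⟩, ?_⟩
      · exact Finset.mem_coe.2 (Finset.mem_image.2 ⟨j, Finset.mem_range.2 hj, rfl⟩)
      · exact dist_eq _ _ (by rwa [abs_sub_comm])
    rcases hσ with rfl | rfl
    · obtain ⟨j, hj, h⟩ := ht.cover _ ⟨w, ⟨hw, hmin⟩, rfl⟩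
      exact ⟨j, by omega, by rw [k1 j hj]; exact h⟩
    · exact hu.cover _ ⟨w, ⟨hw, hmin⟩, rfl⟩

end RealRAM

/-! ### Finiteness of the point spectrum and conclusion -/

theorem Jacobi.ToeplitzPlusFiniteRank.finite_pointSpectrum (T : ToeplitzPlusFiniteRank) :
    (pointSpectrum (free + T.F)).Finite := by
  obtain ⟨m, hm⟩ := T.exists_elim_eq
  obtain ⟨hα, hβm⟩ := T.tail hm
  rw [pointSpectrum_eq T.isJacobi hα hβm]
  have hf : ∀ s : ℝ, ((fun w => ((s * joukowski w : ℝ) : ℂ)) ''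
      zeros (fun k => s * T.α k) T.β m).Finite := fun s =>
    (finite_zeros T.isJacobi.pos).image _
  refine ((hf 1).union (hf (-1))).subset ?_
  rintro _ ⟨s, rfl | rfl, w, hw, hmin, rfl⟩
  · exact Or.inl ⟨w, ⟨hw, hmin⟩, rfl⟩
  · exact Or.inr ⟨w, ⟨hw, hmin⟩, rfl⟩

theorem theorem6p6 :
    RealRAM.ComputableWithErrorControl Jacobi.ToeplitzPlusFiniteRank.load
      (fun T => Jacobi.pointSpectrum (Jacobi.free + T.F)) := by
  classical
  refine ⟨fun T => T.finite_pointSpectrum.isCompact, ?_⟩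
  -- For `ε ≤ 0` the index is read from an arbitrary state; the specification does not constrain it
  -- there.
  have : Nonempty RealRAM.State := ⟨RealRAM.ofReal 0⟩
  choose t ht herr using RealRAM.wp_spectrumProg
  choose! q hq hindex using fun (ε : ℝ) (hε : 0 < ε) => RealRAM.wp_indexProg hε
  refine ⟨fun T n => (t T n).outSet, fun ε => (q ε).outNat, ⟨_, fun T n => ⟨_, ht T n, rfl⟩⟩, ?_,
    ⟨_, fun ε hε => ⟨_, hq ε hε, rfl⟩⟩, ?_⟩
  · intro T
    have h0 : Tendsto (fun n : ℕ => ENNReal.ofReal (1 / ((n : ℝ) + 1))) atTop (𝓝 0) := by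
      simpa using ENNReal.tendsto_ofReal (tendsto_one_div_add_atTop_nhds_zero_nat (𝕜 := ℝ))
    exact tendsto_of_tendsto_of_tendsto_of_le_of_le tendsto_const_nhds h0
      (fun _ => zero_le) (herr T)
  · intro ε hε T n hn
    refine (herr T n).trans_lt ((ENNReal.ofReal_lt_ofReal_iff hε).2 ?_)
    refine lt_of_le_of_lt ?_ (hindex ε hε)
    have : ((q ε).outNat : ℝ) ≤ n := by exact_mod_cast hn
    gcongr
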